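/- Let $\varphi(t)=2^{1/4}e^{-\pi t^2}$ and, for $p=(x,y)\in\mathbb R^2$, let $(\pi(p)g)(t)=e^{2\pi i y t}g(t-x)$. For $f\in L^2(\mathbb R)$ let $\mathcal G f(p)=\int_{\mathbb R} f(t)\,\overline{(\pi(p)\varphi)(t)}\,dt$ be the Gabor transform, $\mathcal S f=|\mathcal G f|^2$ the spectrogram, and $\|\mathcal S f\|_\infty=\|\mathcal S f\|_{L^\infty(\mathbb R^2)}$. Let $\mathfrak a=\frac1{\sqrt2}$. For a finite set $\Gamma\subseteq\mathfrak a\mathbb Z^2$ and $p\in\mathbb R^2$ let $v\in\mathbb C^\Gamma$, $v_\lambda=\mathcal G[\pi(\lambda)\varphi](p)$, let $W_p\in\mathbb C^{\Gamma\times\Gamma}$ be the matrix $(W_p)_{\lambda,\mu}=v_\lambda\overline{v_\mu}$, and let $\langle X,Y\rangle_F=\sum_{\lambda,\mu\in\Gamma}X_{\lambda,\mu}\overline{Y_{\lambda,\mu}}$. For $\varepsilon>0$ and $\Omega\subseteq\mathbb R^2$ let $$Adm_\varepsilon(f,\Gamma,\Omega)=\{A\in\mathbb C^{\Gamma\times\Gamma}:\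 A\succeq0,\ |\langle A,W_p\rangle_F-\mathcal S f(p)|\le\varepsilon\ \text{ for all } p\in\Omega\},$$ and let the associated convex problem be $$\min_{A\in Adm_\varepsilon(f,\Gamma,\Omega)}\ \max_{\lambda\in\Gamma}A_{\lambda,\lambda}$$ (a maximum over the empty set is read as $0$). **Proposition.** Let $f\in L^2(\mathbb R)$, $\varepsilon\in(0,1)$, $s>0$, let $\Omega\subseteq s\mathbb Z^2$, and let $\Gamma\subseteq\mathfrak a\mathbb Z^2$ be finite such that $$\operatorname{dist}\left(\Omega,\mathfrak a\mathbb Z^2\setminus\Gamma\right)\ \ge\ \sqrt{\frac2\pi\ln\left(\frac{53\,\|\mathcal S f\|_\infty}{\varepsilon}\right)}+\frac1{2\sqrt2},$$ where $\operatorname{dist}(S,T)=\inf_{x\in S,\,y\in T}|x-y|$ ($+\infty$ if $S$ or $T$ is empty) and the square root is read as $0$ if $53\|\mathcal S f\|_\infty<\varepsilon$. Then $Adm_\varepsilon(f,\Gamma,\Omega)\neq\emptyset$, and every minimizer $A$ of the associated convex problem satisfies $$\max_{\lambda\in\Gamma}A_{\lambda,\lambda}\le1.6\,\|\mathcal S f\|_\infty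 .$$ The same two conclusions hold for the problem in which the constraints are replaced by $|F_A(p)-\mathcal S f(p)|\le\varepsilon$ for all $p\in\Omega$, where $F_A(z)=\sum_{\lambda,\mu\in\Gamma}A_{\lambda,\mu}\Phi_{\lambda,\mu}(z)$ for $z\in\mathbb C^2$, $$\Phi_{\lambda,\mu}(z)=e^{-\frac\pi4|\lambda-\mu|^2+\pi i(\lambda_1\lambda_2-\mu_1\mu_2)}\;e^{i\pi z^T\mathcal J(\lambda-\mu)}\;e^{-\pi\left(z-\frac{\lambda+\mu}2\right)^2},\qquad \mathcal J=\begin{pmatrix}0&1\\-1&0\end{pmatrix},$$ and $w^2=w_1^2+w_2^2$ for $w\in\mathbb C^2$. -/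

import Mathlib

open MeasureTheory
open scoped ENNReal ComplexOrder

namespace GaborPhase

noncomputable section

/-- The (time-frequency) plane `ℝ²` with its Euclidean distance and Lebesgue measure. -/
abbrev Plane : Type := EuclideanSpace ℝ (Fin 2)

/-- The square lattice `sℤ²`. -/
def squareLattice (s : ℝ) : Set Plane :=
  {p | ∃ k : Fin 2 → ℤ, ∀ i, p i = s * (k i : ℝ)}

/-- The distance of two sets, `inf {|x - y| : x ∈ S, y ∈ T}`, equal to `+∞` if one of them is
empty. -/
def setDist (S T : Set Plane) : ℝ≥0∞ :=
  ⨅ x ∈ S, ⨅ y ∈ T, edist x y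

/-- The `L²`-normalised Gaussian `φ(t) = 2^{1/4} e^{-π t²}`. -/
def gaussian (t : ℝ) : ℂ :=
  (((2 : ℝ) ^ (1 / 4 : ℝ) * Real.exp (-Real.pi * t ^ 2) : ℝ) : ℂ)

/-- The time-frequency shift `(π(p) g)(t) = e^{2π i y t} g(t - x)` for `p = (x, y)`. -/
def timeFreqShift (p : Plane) (g : ℝ → ℂ) (t : ℝ) : ℂ :=
  Complex.exp (2 * Real.pi * Complex.I * (p 1 : ℂ) * (t : ℂ)) * g (t - p 0)

/-- The Gabor transform `𝒢 f(p) = ⟨f, π(p) φ⟩ = ∫ f(t) conj (π(p) φ (t)) dt`. -/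
def gaborTransform (f : ℝ → ℂ) (p : Plane) : ℂ :=
  ∫ t : ℝ, f t * (starRingEnd ℂ) (timeFreqShift p gaussian t)

/-- The spectrogram `𝒮 f = |𝒢 f|²`. -/
def spectrogram (f : ℝ → ℂ) (p : Plane) : ℝ :=
  ‖gaborTransform f p‖ ^ 2

/-- `‖𝒮 f‖_{L^∞(ℝ²)}`; it is finite (at most `‖f‖²`) for square integrable `f`. -/
def spectrogramSup (f : ℝ → ℂ) : ℝ :=
  (eLpNorm (spectrogram f) ∞ volume).toReal

/-- The Frobenius inner product `⟨X, Y⟩_F = ∑ X_{l,m} conj (Y_{l,m})`. -/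
def frobeniusInner {Γ : Finset Plane} (X Y : Matrix Γ Γ ℂ) : ℂ :=
  ∑ l : Γ, ∑ m : Γ, X l m * (starRingEnd ℂ) (Y l m)

/-- The vector `v_l = 𝒢[π(l) φ](p)`, `l ∈ Γ`. -/
def evalVector (Γ : Finset Plane) (p : Plane) (l : Γ) : ℂ :=
  gaborTransform (timeFreqShift (l : Plane) gaussian) p

/-- The matrix `W_p = v ⊗ conj v`, with entries `v_l conj (v_m)`. -/
def evalMatrix (Γ : Finset Plane) (p : Plane) : Matrix Γ Γ ℂ :=
  Matrix.of fun l m => evalVector Γ p l * (starRingEnd ℂ) (evalVector Γ p m)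

/-- The matrix `𝒥 = (0, 1; -1, 0)`. -/
def symplecticJ : Matrix (Fin 2) (Fin 2) ℂ := !![0, 1; -1, 0]

/-- The function
`Φ_{l,m}(z) = C(l,m) exp (i π zᵀ 𝒥 (l - m)) exp (-π (z - (l + m)/2)²)` on `ℂ²`, with
`C(l,m) = exp (-(π/4)|l - m|² + π i (l₁ l₂ - m₁ m₂))` and `w² = w₁² + w₂²` for `w ∈ ℂ²`. -/
def ansatzKernel (l m : Plane) (z : Fin 2 → ℂ) : ℂ :=
  Complex.exp (-(Real.pi / 4 : ℂ) * ((‖l - m‖ ^ 2 : ℝ) : ℂ)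
      + Real.pi * Complex.I * ((l 0 * l 1 - m 0 * m 1 : ℝ) : ℂ)) *
    Complex.exp (Complex.I * Real.pi *
      (z ⬝ᵥ (symplecticJ.mulVec fun i => ((l i - m i : ℝ) : ℂ)))) *
    Complex.exp (-Real.pi * ∑ i, (z i - (((l i + m i) / 2 : ℝ) : ℂ)) ^ 2)

/-- The ansatz function `F_A(z) = ∑_{l,m ∈ Γ} A_{l,m} Φ_{l,m}(z)`, `z ∈ ℂ²`. -/
def ansatzFunction {Γ : Finset Plane} (A : Matrix Γ Γ ℂ) (z : Fin 2 → ℂ) : ℂ :=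
  ∑ l : Γ, ∑ m : Γ, A l m * ansatzKernel (l : Plane) (m : Plane) z

/-- The admissible set `Adm_ε(f, Γ, Ω)`: positive semidefinite `A ∈ ℂ^{Γ × Γ}` with
`|⟨A, W_p⟩_F - 𝒮 f(p)| ≤ ε` for all `p ∈ Ω`. -/
def admissibleSet (ε : ℝ) (f : ℝ → ℂ) (Γ : Finset Plane) (Ω : Set Plane) :
    Set (Matrix Γ Γ ℂ) :=
  {A | A.PosSemidef ∧
    ∀ p ∈ Ω, ‖frobeniusInner A (evalMatrix Γ p) - (spectrogram f p : ℂ)‖ ≤ ε}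

/-- The same set with the constraint expressed by the ansatz function: positive semidefinite
`A ∈ ℂ^{Γ × Γ}` with `|F_A(p) - 𝒮 f(p)| ≤ ε` for all `p ∈ Ω ⊆ ℝ² ⊆ ℂ²`. -/
def ansatzAdmissibleSet (ε : ℝ) (f : ℝ → ℂ) (Γ : Finset Plane) (Ω : Set Plane) :
    Set (Matrix Γ Γ ℂ) :=
  {A | A.PosSemidef ∧
    ∀ p ∈ Ω, ‖ansatzFunction A (fun i => (p i : ℂ)) - (spectrogram f p : ℂ)‖ ≤ ε}

/-- The objective `max_{l ∈ Γ} A_{l,l}` (the diagonal of a positive semidefinite matrix is real;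
the value is `0` if `Γ` is empty). -/
def maxDiagonal {Γ : Finset Plane} (A : Matrix Γ Γ ℂ) : ℝ :=
  ⨆ l : Γ, (A l l).re

/-- `A` solves the problem of minimising `max_{l ∈ Γ} A_{l,l}` over the set `S` of matrices. -/
def IsSolution {Γ : Finset Plane} (S : Set (Matrix Γ Γ ℂ)) (A : Matrix Γ Γ ℂ) : Prop :=
  A ∈ S ∧ IsMinOn maxDiagonal S A

end

end GaborPhase

namespace GaborPhase

/-! A minimizer is no worse than any competitor, so it suffices to exhibit one admissible rank one
matrix with diagonal at most `1.6 * ‖𝒮f‖_∞`. It is built from coefficients `c` for which `∑_Γ c_λ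
𝒢[π(λ)φ]` approximates `𝒢f` on `Ω`; such `c` come from truncating a Gabor frame expansion of `f`.

The Gaussian generates a frame over `(1/√2)ℤ²`. By Poisson summation (`tsum_gaussianCoeff_mul`,
Janssen's representation) its frame operator is twice a multiplication operator composed with a
convolution, both with coefficients `exp(-πk²)` along `√2ℤ`. These two factors commute because `√2 ·
√2 = 2` is an integer. The sequence `exp(-πk²)` is a small perturbation of the unit of `ℓ¹(ℤ)`, so a
Neumann series gives an inverse `b` with `‖b‖₁ ≤ 4/3` (`exists_inverse_thetaCoeff`). Since `√2ℤ²` is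
contained in `(1/√2)ℤ²`, the expansion coefficients of `f` are `½ ∑ b_j b_k` times values of `𝒢f` at
lattice points, hence at most `½ (4/3)² ‖𝒢f‖_∞` (`exists_gabor_expansion`).

Dropping the lattice points outside `Γ` costs a Gaussian tail, estimated by comparing the sum with
an integral over disjoint discs (`sum_gaussian_le_of_separated`). The distance hypothesis makes this
tail of order `ε / ‖𝒮f‖_∞` on `Ω`, and squaring moduli keeps the error within `ε`
(`exists_admissible_vector`). -/

/-! ### Gabor transforms of shifted Gaussians. -/

lemma plane_norm_sub_sq (l p : Plane) : ‖l - p‖ ^ 2 = (l 0 - p 0) ^ 2 + (l 1 - p 1) ^ 2 := by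
  rw [EuclideanSpace.norm_sq_eq]
  simp [Fin.sum_univ_two]

lemma gaussian_eq_cexp (t : ℝ) :
    gaussian t = ((2 : ℝ) ^ (1 / 4 : ℝ) : ℝ) * Complex.exp (-Real.pi * (t : ℂ) ^ 2) := by
  simp [gaussian]

lemma two_rpow_quarter_mul_self :
    (2 : ℝ) ^ (1 / 4 : ℝ) * (2 : ℝ) ^ (1 / 4 : ℝ) = Real.sqrt 2 := by
  rw [← Real.rpow_add (by norm_num), Real.sqrt_eq_rpow]
  norm_num

lemma two_rpow_quarter_mul_self_complex :
    (((2 : ℝ) ^ (1 / 4 : ℝ) : ℝ) : ℂ) * (((2 : ℝ) ^ (1 / 4 : ℝ) : ℝ) : ℂ) = (Real.sqrt 2 : ℝ) := by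
  rw [← Complex.ofReal_mul, two_rpow_quarter_mul_self]

lemma conj_timeFreqShift_gaussian (p : Plane) (t : ℝ) :
    (starRingEnd ℂ) (timeFreqShift p gaussian t) =
      ((2 : ℝ) ^ (1 / 4 : ℝ) : ℝ) * Complex.exp (-(2 * Real.pi * Complex.I * (p 1 : ℂ) * (t : ℂ))
        - Real.pi * ((t : ℂ) - (p 0 : ℂ)) ^ 2) := by
  rw [timeFreqShift, gaussian_eq_cexp, map_mul, map_mul, ← Complex.exp_conj, ← Complex.exp_conj,
    Complex.conj_ofReal, mul_left_comm, ← Complex.exp_add]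
  simp only [map_mul, map_neg, map_pow, Complex.conj_ofReal, Complex.conj_I, map_ofNat]
  congr 2
  push_cast
  ring

/-- The Gabor transform of a shifted Gaussian. -/
lemma gaborTransform_timeFreqShift_gaussian (l p : Plane) :
    gaborTransform (timeFreqShift l gaussian) p =
      Complex.exp (-(Real.pi / 2) * (((l 0 : ℂ) - p 0) ^ 2 + ((l 1 : ℂ) - p 1) ^ 2)
        + Real.pi * Complex.I * ((l 1 : ℂ) - p 1) * ((l 0 : ℂ) + p 0)) := by
  have key : ∀ t : ℝ, timeFreqShift l gaussian t * (starRingEnd ℂ) (timeFreqShift p gaussian t) =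
      (Real.sqrt 2 : ℝ) * Complex.exp ((-(2 * Real.pi) : ℂ) * (t : ℂ) ^ 2 +
        (2 * Real.pi * Complex.I * ((l 1 : ℂ) - p 1) + 2 * Real.pi * ((l 0 : ℂ) + p 0)) * t +
        (-Real.pi * ((l 0 : ℂ) ^ 2 + (p 0 : ℂ) ^ 2))) := by
    intro t
    rw [conj_timeFreqShift_gaussian, timeFreqShift, gaussian_eq_cexp,
      ← two_rpow_quarter_mul_self_complex]
    rw [show ∀ a b c d : ℂ, a * (b * c) * (b * d) = b * b * (a * c * d) from
      fun a b c d => by ring, ← Complex.exp_add, ← Complex.exp_add]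
    congr 2
    push_cast
    ring
  have hpi : (Real.pi : ℂ) ≠ 0 := by exact_mod_cast Real.pi_ne_zero
  unfold gaborTransform
  simp_rw [key]
  rw [integral_const_mul, integral_cexp_quadratic
    (by simp [Real.pi_pos] : (-(2 * Real.pi) : ℂ).re < 0)]
  have h2 : ((Real.pi : ℂ) / - -(2 * Real.pi)) ^ (1 / 2 : ℂ) = (((Real.sqrt 2)⁻¹ : ℝ) : ℂ) := by
    have : ((Real.pi : ℂ) / - -(2 * Real.pi)) = (((1 / 2 : ℝ)) : ℂ) := by
      push_cast; field_simp
    rw [this, show (1 / 2 : ℂ) = ((1 / 2 : ℝ) : ℂ) by norm_num,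
      ← Complex.ofReal_cpow (by norm_num), ← Real.sqrt_eq_rpow, ← Real.sqrt_inv]
    norm_num
  rw [h2, ← mul_assoc, ← Complex.ofReal_mul, mul_inv_cancel₀ (by positivity), Complex.ofReal_one,
    one_mul]
  congr 1
  field_simp
  ring_nf
  simp only [Complex.I_sq]
  ring

lemma norm_gaborTransform_timeFreqShift_gaussian (l p : Plane) :
    ‖gaborTransform (timeFreqShift l gaussian) p‖ = Real.exp (-(Real.pi / 2) * ‖l - p‖ ^ 2) := by
  rw [gaborTransform_timeFreqShift_gaussian, Complex.norm_exp, plane_norm_sub_sq]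
  congr 1
  rw [show (-(Real.pi / 2) * (((l 0 : ℂ) - p 0) ^ 2 + ((l 1 : ℂ) - p 1) ^ 2)
        + Real.pi * Complex.I * ((l 1 : ℂ) - p 1) * ((l 0 : ℂ) + p 0)) =
      ((-(Real.pi / 2) * ((l 0 - p 0) ^ 2 + (l 1 - p 1) ^ 2) : ℝ) : ℂ) +
        ((Real.pi * (l 1 - p 1) * (l 0 + p 0) : ℝ) : ℂ) * Complex.I by push_cast; ring]
  simp only [Complex.add_re, Complex.ofReal_re, Complex.re_ofReal_mul, Complex.I_re, mul_zero,
    add_zero]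

/-- On real points the kernel of the ansatz factorises. -/
lemma ansatzKernel_ofReal (l m p : Plane) :
    ansatzKernel l m (fun i => (p i : ℂ)) =
      gaborTransform (timeFreqShift l gaussian) p *
        (starRingEnd ℂ) (gaborTransform (timeFreqShift m gaussian) p) := by
  rw [gaborTransform_timeFreqShift_gaussian, gaborTransform_timeFreqShift_gaussian,
    ← Complex.exp_conj, ← Complex.exp_add, ansatzKernel, ← Complex.exp_add, ← Complex.exp_add,
    plane_norm_sub_sq]
  congr 1
  simp only [symplecticJ, Matrix.mulVec, dotProduct, Fin.sum_univ_two, Matrix.of_apply,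
    Matrix.cons_val_zero, Matrix.cons_val_one, map_add, map_mul, map_neg, map_pow,
    map_sub, Complex.conj_ofReal, Complex.conj_I, map_div₀, map_ofNat, Matrix.cons_val', Matrix.cons_val_fin_one]
  push_cast
  ring

/-! ### Continuity and boundedness of the Gabor transform. -/

lemma norm_timeFreqShift_gaussian (p : Plane) (t : ℝ) :
    ‖timeFreqShift p gaussian t‖ =
      (2 : ℝ) ^ (1 / 4 : ℝ) * Real.exp (-Real.pi * (t - p 0) ^ 2) := by
  have h : 2 * Real.pi * Complex.I * (p 1 : ℂ) * (t : ℂ) =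
    ((2 * Real.pi * p 1 * t : ℝ) : ℂ) * Complex.I := by push_cast; ring
  rw [timeFreqShift, norm_mul, h, Complex.norm_exp_ofReal_mul_I, one_mul, gaussian,
    Complex.norm_real, Real.norm_of_nonneg (by positivity)]

lemma continuous_timeFreqShift_gaussian :
    Continuous fun q : Plane × ℝ => timeFreqShift q.1 gaussian q.2 := by
  unfold timeFreqShift gaussian
  fun_prop

lemma memLp_two_exp_neg_mul_sq {b : ℝ} (hb : 0 < b) (x : ℝ) :
    MemLp (fun t : ℝ => Real.exp (-b * (t - x) ^ 2)) 2 := by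
  rw [memLp_two_iff_integrable_sq_norm (by fun_prop)]
  have h := (integrable_exp_neg_mul_sq (b := 2 * b) (by positivity)).comp_sub_right x
  refine h.congr (Filter.Eventually.of_forall fun t => ?_)
  simp only [Real.norm_eq_abs, Real.abs_exp, ← Real.exp_nat_mul]
  congr 1
  push_cast
  ring

variable {f : ℝ → ℂ}

lemma integrable_norm_mul_exp_neg_mul_sq (hf : MemLp f 2) {b : ℝ} (hb : 0 < b) (x : ℝ) :
    Integrable fun t : ℝ => ‖f t‖ * Real.exp (-b * (t - x) ^ 2) :=
  hf.norm.integrable_mul (memLp_two_exp_neg_mul_sq hb x)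

lemma integrable_mul_conj_timeFreqShift (hf : MemLp f 2) (p : Plane) :
    Integrable fun t : ℝ => f t * (starRingEnd ℂ) (timeFreqShift p gaussian t) := by
  refine ((integrable_norm_mul_exp_neg_mul_sq hf Real.pi_pos (p 0)).const_mul
    ((2 : ℝ) ^ (1 / 4 : ℝ))).mono' ?_ (Filter.Eventually.of_forall fun t => ?_)
  · refine hf.1.mul (Continuous.aestronglyMeasurable ?_)
    exact Complex.continuous_conj.comp
      (continuous_timeFreqShift_gaussian.comp (Continuous.prodMk_right p))
  · rw [norm_mul, RCLike.norm_conj, norm_timeFreqShift_gaussian]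
    exact le_of_eq (by ring)

/-- `L²`-norm of `f`, up to normalisation, bounds the integrals `∫ |f(t)| |π(p)φ(t)| dt`
uniformly in `p`. -/
lemma exists_integral_norm_mul_conj_timeFreqShift_le (hf : MemLp f 2) :
    ∃ M : ℝ, 0 ≤ M ∧ ∀ p : Plane,
      ∫ t : ℝ, ‖f t * (starRingEnd ℂ) (timeFreqShift p gaussian t)‖ ≤ M := by
  have hf2 : Integrable fun t => ‖f t‖ ^ 2 := (memLp_two_iff_integrable_sq_norm hf.1).1 hf
  have hg : Integrable fun t : ℝ => ((2 : ℝ) ^ (1 / 4 : ℝ) * Real.exp (-Real.pi * t ^ 2)) ^ 2 := by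
    have h0 := memLp_two_exp_neg_mul_sq Real.pi_pos 0
    have h := ((memLp_two_iff_integrable_sq_norm h0.1).1 h0).const_mul
      (((2 : ℝ) ^ (1 / 4 : ℝ)) ^ 2)
    refine h.congr (Filter.Eventually.of_forall fun t => ?_)
    simp only [Real.norm_eq_abs, Real.abs_exp, mul_pow, sub_zero]
  -- Cruder than Cauchy–Schwarz, but the size of `M` never matters: it only serves finiteness and
  -- summability.
  have hab : ∀ a b : ℝ, a * b ≤ a ^ 2 + b ^ 2 := fun a b => by
    nlinarith [sq_nonneg (a - b), sq_nonneg a, sq_nonneg b]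
  refine ⟨∫ t, ‖f t‖ ^ 2 + ((2 : ℝ) ^ (1 / 4 : ℝ) * Real.exp (-Real.pi * t ^ 2)) ^ 2,
    integral_nonneg fun t => by positivity, fun p => ?_⟩
  have hp := hg.comp_sub_right (p 0)
  calc _ ≤ ∫ t : ℝ, (‖f t‖ ^ 2 +
        ((2 : ℝ) ^ (1 / 4 : ℝ) * Real.exp (-Real.pi * (t - p 0) ^ 2)) ^ 2) := by
        refine integral_mono (integrable_mul_conj_timeFreqShift hf p).norm (hf2.add hp)
          fun t => ?_
        simp only [norm_mul, RCLike.norm_conj, norm_timeFreqShift_gaussian]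
        exact hab _ _
    _ = _ := by
        rw [integral_add hf2 hp, integral_add hf2 hg]
        congr 1
        exact integral_sub_right_eq_self
          (fun t : ℝ => ((2 : ℝ) ^ (1 / 4 : ℝ) * Real.exp (-Real.pi * t ^ 2)) ^ 2) (p 0)

/-- Dominated convergence: for `p` within horizontal distance 1 of `p₀`, all shifted Gaussians lie
below one wider Gaussian centred at `p₀ 0`. -/
lemma continuous_gaborTransform (hf : MemLp f 2) : Continuous (gaborTransform f) := by
  rw [continuous_iff_continuousAt]
  intro p₀
  refine continuousAt_of_dominated (bound := fun t => (2 : ℝ) ^ (1 / 4 : ℝ) * Real.exp Real.pi *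
    (‖f t‖ * Real.exp (-(Real.pi / 2) * (t - p₀ 0) ^ 2)))
    (Filter.Eventually.of_forall fun p => (integrable_mul_conj_timeFreqShift hf p).1) ?_
    ((integrable_norm_mul_exp_neg_mul_sq hf (by positivity) (p₀ 0)).const_mul _) ?_
  · have hc : Continuous fun p : Plane => p 0 - p₀ 0 := by fun_prop
    have hnear : ∀ᶠ p : Plane in nhds p₀, |p 0 - p₀ 0| < 1 := by
      refine hc.abs.continuousAt.eventually_lt continuousAt_const ?_
      simp
    filter_upwards [hnear] with p hp
    refine Filter.Eventually.of_forall fun t => ?_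
    rw [norm_mul, RCLike.norm_conj, norm_timeFreqShift_gaussian]
    have h1 : (p 0 - p₀ 0) ^ 2 ≤ 1 := by
      rw [← sq_abs]; nlinarith [abs_nonneg (p 0 - p₀ 0)]
    have h2 : Real.exp (-Real.pi * (t - p 0) ^ 2) ≤
        Real.exp Real.pi * Real.exp (-(Real.pi / 2) * (t - p₀ 0) ^ 2) := by
      rw [← Real.exp_add, Real.exp_le_exp]
      have : (t - p₀ 0) ^ 2 ≤ 2 * (t - p 0) ^ 2 + 2 := by
        nlinarith [sq_nonneg ((t - p 0) - (p 0 - p₀ 0))]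
      nlinarith [Real.pi_pos]
    calc ‖f t‖ * ((2 : ℝ) ^ (1 / 4 : ℝ) * Real.exp (-Real.pi * (t - p 0) ^ 2))
        ≤ ‖f t‖ * ((2 : ℝ) ^ (1 / 4 : ℝ) *
          (Real.exp Real.pi * Real.exp (-(Real.pi / 2) * (t - p₀ 0) ^ 2))) := by gcongr
      _ = _ := by ring
  · refine Filter.Eventually.of_forall fun t => ?_
    exact (continuous_const.mul (Complex.continuous_conj.comp
      (continuous_timeFreqShift_gaussian.comp (Continuous.prodMk_left t)))).continuousAt

lemma spectrogramSup_nonneg (f : ℝ → ℂ) : 0 ≤ spectrogramSup f := ENNReal.toReal_nonneg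

/-- The essential supremum bounds almost every value, and continuity upgrades this to every value,
the good set being closed and dense. Boundedness is proved first because `toReal` would send an
infinite norm to `0`. -/
lemma spectrogram_le_spectrogramSup (hf : MemLp f 2) (p : Plane) :
    spectrogram f p ≤ spectrogramSup f := by
  obtain ⟨M, hM0, hM⟩ := exists_integral_norm_mul_conj_timeFreqShift_le hf
  have hcont : Continuous (spectrogram f) := (continuous_gaborTransform hf).norm.pow 2
  have hbound : ∀ q, ‖spectrogram f q‖ ≤ M ^ 2 := by
    intro q
    rw [spectrogram, norm_pow, norm_norm]
    have : ‖gaborTransform f q‖ ≤ M := (norm_integral_le_integral_norm _).trans (hM q)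
    gcongr
  have hmem : MemLp (spectrogram f) ∞ volume :=
    memLp_top_of_bound hcont.aestronglyMeasurable (M ^ 2) (Filter.Eventually.of_forall hbound)
  have hae : ∀ᵐ q ∂(volume : Measure Plane), spectrogram f q ≤ spectrogramSup f := by
    have h := ae_le_eLpNormEssSup (f := spectrogram f) (μ := (volume : Measure Plane))
    filter_upwards [h] with q hq
    have h2 := ENNReal.toReal_mono (by simpa [eLpNorm_exponent_top] using hmem.eLpNorm_ne_top) hq
    rw [spectrogramSup, eLpNorm_exponent_top]
    refine le_trans ?_ h2
    simpa using le_abs_self (spectrogram f q)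
  have hd := Measure.dense_of_ae hae
  have hcl : IsClosed {q | spectrogram f q ≤ spectrogramSup f} :=
    isClosed_le hcont continuous_const
  have := hcl.closure_eq ▸ hd.closure_eq
  exact (Set.eq_univ_iff_forall.1 this) p

lemma norm_gaborTransform_le (hf : MemLp f 2) (p : Plane) :
    ‖gaborTransform f p‖ ≤ Real.sqrt (spectrogramSup f) :=
  Real.le_sqrt_of_sq_le (spectrogram_le_spectrogramSup hf p)

/-! ### Inversion of `δ + r` in `ℓ¹(ℤ)` by a Neumann series. -/

/-- The iterated convolution powers `r^{*n}` of a sequence `r : ℤ → ℝ`. -/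
noncomputable def convPow (r : ℤ → ℝ) : ℕ → ℤ → ℝ
  | 0 => Pi.single 0 1
  | n + 1 => fun m => ∑' k : ℤ, convPow r n (m - k) * r k

/-- The shear `(m, k) ↦ (m - k, k)` of `ℤ × ℤ`. -/
def shearEquiv : ℤ × ℤ ≃ ℤ × ℤ where
  toFun x := (x.1 - x.2, x.2)
  invFun x := (x.1 + x.2, x.2)
  left_inv x := by simp
  right_inv x := by simp

lemma convPow_nonneg {r : ℤ → ℝ} (hr : ∀ k, 0 ≤ r k) (n : ℕ) : ∀ m, 0 ≤ convPow r n m := by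
  induction n with
  | zero => intro m; by_cases h : m = 0 <;> simp [convPow, h]
  | succ n ih => intro m; exact tsum_nonneg fun k => mul_nonneg (ih _) (hr k)

lemma hasSum_convPow {r : ℤ → ℝ} (hr : ∀ k, 0 ≤ r k) {ρ : ℝ} (hρ : HasSum r ρ) (n : ℕ) :
    HasSum (convPow r n) (ρ ^ n) := by
  induction n with
  | zero => simpa [convPow] using hasSum_pi_single (0 : ℤ) (1 : ℝ)
  | succ n ih =>
    have h1 : Summable fun x : ℤ × ℤ => convPow r n x.1 * r x.2 :=
      ih.summable.mul_of_nonneg hρ.summable (convPow_nonneg hr n) hr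
    have h2 : HasSum (fun x : ℤ × ℤ => convPow r n x.1 * r x.2) (ρ ^ n * ρ) := by
      have := ih.mul hρ h1
      exact this
    have h3 := (shearEquiv.hasSum_iff.2 h2)
    have h4 := h3.prod_fiberwise fun m => (h3.summable.prod_factor m).hasSum
    rw [pow_succ]
    exact h4

/-- Fubini after a shear: one factor `r` is moved from the convolution power onto the test sequence.
This is the step that makes the Neumann series telescope. -/
lemma hasSum_convPow_succ_mul {r : ℤ → ℝ} (hr : ∀ k, 0 ≤ r k) (hs : Summable r) (n : ℕ)
    {u : ℤ → ℂ} {B : ℝ} (hu : ∀ m, ‖u m‖ ≤ B) :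
    ∑' m, (convPow r (n + 1) m : ℂ) * u m =
      ∑' m, (convPow r n m : ℂ) * ∑' k, (r k : ℂ) * u (m + k) := by
  have h0 := (hasSum_convPow hr hs.hasSum n).summable
  have h1 : Summable fun x : ℤ × ℤ => convPow r n x.1 * r x.2 :=
    h0.mul_of_nonneg hs (convPow_nonneg hr n) hr
  have h2 : Summable fun x : ℤ × ℤ => ((convPow r n x.1 : ℂ) * r x.2) * u (x.1 + x.2) := by
    refine Summable.of_norm_bounded (h1.mul_right B) fun x => ?_
    rw [norm_mul, norm_mul, Complex.norm_real, Complex.norm_real,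
      Real.norm_of_nonneg (convPow_nonneg hr n _), Real.norm_of_nonneg (hr _)]
    exact mul_le_mul_of_nonneg_left (hu _) (mul_nonneg (convPow_nonneg hr n _) (hr _))
  have h3 := (shearEquiv.hasSum_iff.2 h2.hasSum)
  have h4 := h3.prod_fiberwise fun m => (h3.summable.prod_factor m).hasSum
  have h5 := h2.hasSum.prod_fiberwise fun m => (h2.prod_factor m).hasSum
  rw [← h5.tsum_eq] at h4
  calc _ = ∑' m, ∑' k, ((fun x : ℤ × ℤ => ((convPow r n x.1 : ℂ) * r x.2) * u (x.1 + x.2))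
          ∘ shearEquiv) (m, k) := by
        refine tsum_congr fun m => ?_
        simp only [convPow, Complex.ofReal_tsum, ← tsum_mul_right]
        refine tsum_congr fun k => ?_
        simp [shearEquiv]
    _ = _ := h4.tsum_eq
    _ = _ := by
        refine tsum_congr fun m => ?_
        rw [← tsum_mul_left]
        exact tsum_congr fun k => by ring

/-- A perturbation `δ + r` of the unit of `ℓ¹(ℤ)`, `r ≥ 0` of norm `ρ < 1`, is invertible: the
inverse has norm at most `1 / (1 - ρ)`. The inverse is tested against bounded sequences. -/
lemma exists_convolution_inverse {r : ℤ → ℝ} (hr : ∀ k, 0 ≤ r k) {ρ : ℝ} (hρ : HasSum r ρ)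
    (hρ1 : ρ < 1) :
    ∃ b : ℤ → ℝ, Summable (fun m => |b m|) ∧ ∑' m, |b m| ≤ (1 - ρ)⁻¹ ∧
      ∀ (u : ℤ → ℂ) (B : ℝ), (∀ m, ‖u m‖ ≤ B) →
        ∑' m, (b m : ℂ) * (u m + ∑' k, (r k : ℂ) * u (m + k)) = u 0 := by
  have hρ0 : 0 ≤ ρ := hρ.nonneg hr
  have hP := hasSum_convPow hr hρ
  have hgeo := hasSum_geometric_of_lt_one hρ0 hρ1
  have hsum : Summable fun x : ℕ × ℤ => convPow r x.1 x.2 := by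
    rw [summable_prod_of_nonneg fun x => convPow_nonneg hr _ _]
    refine ⟨fun n => (hP n).summable, ?_⟩
    simp_rw [fun n => (hP n).tsum_eq]
    exact hgeo.summable
  have hsum' : HasSum (fun x : ℤ × ℕ => convPow r x.2 x.1) (1 - ρ)⁻¹ := by
    have : HasSum (fun x : ℕ × ℤ => convPow r x.1 x.2) (1 - ρ)⁻¹ := by
      have h := hsum.hasSum.prod_fiberwise hP
      exact h.unique hgeo ▸ hsum.hasSum
    exact (Equiv.prodComm ℤ ℕ).hasSum_iff.2 this
  have hcol := hsum'.prod_fiberwise fun m => (hsum'.summable.prod_factor m).hasSum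
  have hb : ∀ m, |∑' n, (-1 : ℝ) ^ n * convPow r n m| ≤ ∑' n, convPow r n m := by
    intro m
    have := hsum'.summable.prod_factor m
    have hn : Summable fun n => ‖(-1 : ℝ) ^ n * convPow r n m‖ := by
      refine this.congr fun n => ?_
      simp [abs_of_nonneg (convPow_nonneg hr n m)]
    refine (norm_tsum_le_tsum_norm hn).trans (le_of_eq (tsum_congr fun n => ?_))
    simp [abs_of_nonneg (convPow_nonneg hr n m)]
  have hbs : Summable fun m => |∑' n, (-1 : ℝ) ^ n * convPow r n m| :=
    Summable.of_nonneg_of_le (fun _ => abs_nonneg _) hb hcol.summable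
  -- The witness is the Neumann series `∑ (-1)ⁿ r^{*n}`; its norm is at most `∑ ρⁿ`.
  refine ⟨fun m => ∑' n, (-1 : ℝ) ^ n * convPow r n m, hbs,
    (hbs.tsum_le_tsum hb hcol.summable).trans hcol.tsum_eq.le, fun u B hu => ?_⟩
  set R : ℤ → ℂ := fun m => ∑' k, (r k : ℂ) * u (m + k) with hR
  have hRb : ∀ m, ‖R m‖ ≤ ρ * B := by
    intro m
    refine tsum_of_norm_bounded (hρ.mul_right B) fun k => ?_
    rw [norm_mul, Complex.norm_real, Real.norm_of_nonneg (hr k)]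
    exact mul_le_mul_of_nonneg_left (hu _) (hr k)
  have hT : ∀ n, Summable fun m => (convPow r n m : ℂ) * u m := fun n =>
    Summable.of_norm_bounded ((hP n).summable.mul_right B) fun m => by
      rw [norm_mul, Complex.norm_real, Real.norm_of_nonneg (convPow_nonneg hr n m)]
      exact mul_le_mul_of_nonneg_left (hu _) (convPow_nonneg hr n m)
  have hTR : ∀ n, Summable fun m => (convPow r n m : ℂ) * R m := fun n =>
    Summable.of_norm_bounded ((hP n).summable.mul_right (ρ * B)) fun m => by
      rw [norm_mul, Complex.norm_real, Real.norm_of_nonneg (convPow_nonneg hr n m)]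
      exact mul_le_mul_of_nonneg_left (hRb _) (convPow_nonneg hr n m)
  set a : ℕ → ℂ := fun n => ∑' m, (convPow r n m : ℂ) * u m with ha
  have han : ∀ n, ‖a n‖ ≤ ρ ^ n * B := fun n =>
    tsum_of_norm_bounded ((hP n).mul_right B) fun m => by
      rw [norm_mul, Complex.norm_real, Real.norm_of_nonneg (convPow_nonneg hr n m)]
      exact mul_le_mul_of_nonneg_left (hu _) (convPow_nonneg hr n m)
  have hstep : ∀ n, a (n + 1) = ∑' m, (convPow r n m : ℂ) * R m := fun n =>
    hasSum_convPow_succ_mul hr hρ.summable n hu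
  have hint : Summable fun x : ℤ × ℕ =>
      ((-1 : ℂ) ^ x.2 * convPow r x.2 x.1) * (u x.1 + R x.1) := by
    refine Summable.of_norm_bounded (hsum'.summable.mul_right (B + ρ * B)) fun x => ?_
    rw [norm_mul, norm_mul, norm_pow, norm_neg, norm_one, one_pow, one_mul, Complex.norm_real,
      Real.norm_of_nonneg (convPow_nonneg hr _ _)]
    exact mul_le_mul_of_nonneg_left ((norm_add_le _ _).trans (add_le_add (hu _) (hRb _)))
      (convPow_nonneg hr _ _)
  have hA : Summable fun n => (-1 : ℂ) ^ n * a n := by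
    refine Summable.of_norm_bounded (hgeo.summable.mul_right B) fun n => ?_
    rw [norm_mul, norm_pow, norm_neg, norm_one, one_pow, one_mul]
    exact han n
  calc _ = ∑' m, ∑' n, ((-1 : ℂ) ^ n * convPow r n m) * (u m + R m) := by
        refine tsum_congr fun m => ?_
        rw [tsum_mul_right, Complex.ofReal_tsum]
        push_cast
        rfl
    _ = ∑' n, ∑' m, ((-1 : ℂ) ^ n * convPow r n m) * (u m + R m) :=
        (Summable.tsum_comm (f := fun m n => ((-1 : ℂ) ^ n * convPow r n m) * (u m + R m)) hint).symm
    -- Pairing `r^{*n}` with `R` gives `a (n + 1)`, so the sum telescopes to `a 0 = u 0`.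
    _ = ∑' n, ((-1 : ℂ) ^ n * a n - (-1 : ℂ) ^ (n + 1) * a (n + 1)) := by
        refine tsum_congr fun n => ?_
        rw [hstep, ha]
        simp only [mul_assoc, mul_add]
        rw [Summable.tsum_add ((hT n).mul_left _) ((hTR n).mul_left _), tsum_mul_left,
          tsum_mul_left, pow_succ]
        ring
    _ = a 0 := by
        rw [Summable.tsum_sub hA ((summable_nat_add_iff 1).2 hA), hA.tsum_eq_zero_add]
        simp
    _ = u 0 := by
        rw [ha]
        simp only [convPow]
        rw [tsum_eq_single 0]
        · simp
        · intro m hm; simp [hm]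

/-! ### The sequence `exp(-πk²)` and its inverse. -/

lemma exp_pi_ge : 16 ≤ Real.exp Real.pi := by
  have h1 : Real.exp 3 ≤ Real.exp Real.pi := Real.exp_le_exp.2 Real.pi_gt_three.le
  have h2 : Real.exp 3 = Real.exp 1 ^ 3 := by rw [← Real.exp_nat_mul]; norm_num
  have h3 := Real.exp_one_gt_d9
  have : (2.7 : ℝ) ^ 3 ≤ Real.exp 1 ^ 3 := by gcongr; linarith
  norm_num at this
  linarith

/-- The sequence `exp (-π k²)`, `k ∈ ℤ`. -/
noncomputable def thetaCoeff (k : ℤ) : ℝ := Real.exp (-Real.pi * (k : ℝ) ^ 2)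

lemma thetaCoeff_nonneg (k : ℤ) : 0 ≤ thetaCoeff k := (Real.exp_pos _).le

lemma thetaCoeff_neg (k : ℤ) : thetaCoeff (-k) = thetaCoeff k := by simp [thetaCoeff]

lemma thetaCoeff_zero : thetaCoeff 0 = 1 := by simp [thetaCoeff]

lemma thetaCoeff_succ_le (n : ℕ) : thetaCoeff ((n : ℤ) + 1) ≤ (1 / 16 : ℝ) ^ n * (1 / 16) := by
  have h : thetaCoeff ((n : ℤ) + 1) ≤ Real.exp (-Real.pi) ^ (n + 1) := by
    rw [← Real.exp_nat_mul, thetaCoeff, Real.exp_le_exp]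
    push_cast
    have : (0 : ℝ) ≤ n := n.cast_nonneg
    nlinarith [Real.pi_pos, mul_nonneg Real.pi_pos.le (mul_nonneg this (by linarith : (0:ℝ) ≤ n + 1))]
  refine h.trans ?_
  rw [← pow_succ]
  gcongr
  rw [Real.exp_neg, one_div]
  exact inv_anti₀ (by norm_num) exp_pi_ge

/-- Each half of the punctured sum is dominated by a geometric series of ratio `1/16` with sum
`1/15`. The bound `1/4` is a convenient weakening of `2/15` and leads to the norm `4/3` of the
inverse. -/
lemma hasSum_thetaCoeff_tail :
    ∃ ρ : ℝ, ρ ≤ 1 / 4 ∧ HasSum (fun k : ℤ => if k = 0 then 0 else thetaCoeff k) ρ := by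
  have hg : HasSum (fun n : ℕ => (1 / 16 : ℝ) ^ n * (1 / 16)) (1 / 15) := by
    have := (hasSum_geometric_of_lt_one (r := (1 / 16 : ℝ)) (by norm_num) (by norm_num)).mul_right
      (1 / 16)
    norm_num at this ⊢
    exact this
  have hs : Summable fun n : ℕ => thetaCoeff ((n : ℤ) + 1) :=
    Summable.of_nonneg_of_le (fun n => thetaCoeff_nonneg _) thetaCoeff_succ_le hg.summable
  have hle : ∑' n : ℕ, thetaCoeff ((n : ℤ) + 1) ≤ 1 / 15 :=
    (hs.tsum_le_tsum thetaCoeff_succ_le hg.summable).trans hg.tsum_eq.le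
  have h1 : HasSum (fun n : ℕ => if (n : ℤ) = 0 then 0 else thetaCoeff (n : ℤ))
      (∑' n : ℕ, thetaCoeff ((n : ℤ) + 1)) := by
    rw [← hasSum_nat_add_iff' 1]
    simp only [Finset.range_one, Finset.sum_singleton, Nat.cast_zero, if_true, sub_zero]
    have heq : (fun n : ℕ => if ((n + 1 : ℕ) : ℤ) = 0 then 0 else thetaCoeff ((n + 1 : ℕ) : ℤ)) =
        fun n : ℕ => thetaCoeff ((n : ℤ) + 1) := by
      funext n
      rw [if_neg (by omega), Nat.cast_succ]
    rw [heq]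
    exact hs.hasSum
  have h2 : HasSum (fun n : ℕ => if (-((n : ℤ) + 1)) = 0 then 0 else thetaCoeff (-((n : ℤ) + 1)))
      (∑' n : ℕ, thetaCoeff ((n : ℤ) + 1)) := by
    convert hs.hasSum using 2 with n
    rw [if_neg (by omega), thetaCoeff_neg]
  exact ⟨_, by linarith, HasSum.of_nat_of_neg_add_one h1 h2⟩

lemma summable_thetaCoeff : Summable thetaCoeff := by
  obtain ⟨ρ, -, h⟩ := hasSum_thetaCoeff_tail
  have h2 := h.summable.add (hasSum_pi_single (0 : ℤ) (1 : ℝ)).summable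
  refine h2.congr fun k => ?_
  by_cases hk : k = 0
  · subst hk; simp [thetaCoeff_zero]
  · simp [hk]

/-- The inverse in `ℓ¹(ℤ)` of the sequence `exp (-π k²)`. -/
lemma exists_inverse_thetaCoeff :
    ∃ b : ℤ → ℝ, Summable (fun m => |b m|) ∧ ∑' m, |b m| ≤ 4 / 3 ∧
      ∀ (u : ℤ → ℂ) (B : ℝ), (∀ m, ‖u m‖ ≤ B) →
        ∑' m, (b m : ℂ) * ∑' k, (thetaCoeff k : ℂ) * u (m + k) = u 0 := by
  obtain ⟨ρ, hρ, h⟩ := hasSum_thetaCoeff_tail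
  have hr : ∀ k : ℤ, 0 ≤ (if k = 0 then 0 else thetaCoeff k) := by
    intro k; split_ifs; exacts [le_rfl, thetaCoeff_nonneg k]
  obtain ⟨b, hb1, hb2, hb3⟩ := exists_convolution_inverse hr h (by linarith)
  refine ⟨b, hb1, hb2.trans ?_, fun u B hu => ?_⟩
  · rw [show (4 / 3 : ℝ) = (3 / 4)⁻¹ by norm_num]
    exact inv_anti₀ (by norm_num) (by linarith)
  · rw [← hb3 u B hu]
    refine tsum_congr fun m => ?_
    congr 1
    have hsum : Summable fun k : ℤ => (thetaCoeff k : ℂ) * u (m + k) :=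
      Summable.of_norm_bounded (summable_thetaCoeff.mul_right B) fun k => by
        rw [norm_mul, Complex.norm_real, Real.norm_of_nonneg (thetaCoeff_nonneg k)]
        exact mul_le_mul_of_nonneg_left (hu _) (thetaCoeff_nonneg k)
    rw [hsum.tsum_eq_add_tsum_ite 0]
    simp only [thetaCoeff_zero, Complex.ofReal_one, one_mul, add_zero]
    congr 1
    refine tsum_congr fun k => ?_
    split_ifs <;> simp

/-! ### Gaussian sums over separated sets in the plane. -/

lemma integrable_gaussian_plane : Integrable fun x : Plane => Real.exp (-(Real.pi / 2) * ‖x‖ ^ 2) := by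
  have h := GaussianFourier.integrable_cexp_neg_mul_sq_norm_add (V := Plane) (b := (Real.pi / 2 : ℝ))
    (by simp [Real.pi_pos]) 0 0
  refine h.norm.congr (Filter.Eventually.of_forall fun x => ?_)
  simp only [Complex.norm_exp]
  congr 1
  simp [← Complex.ofReal_pow]

lemma volume_real_ball (x : Plane) {δ : ℝ} (hδ : 0 ≤ δ) :
    volume.real (Metric.ball x δ) = Real.pi * δ ^ 2 := by
  rw [measureReal_def, EuclideanSpace.volume_ball_fin_two, ENNReal.toReal_mul, ENNReal.toReal_pow,
    ENNReal.toReal_ofReal hδ, ENNReal.toReal_ofReal Real.pi_pos.le, mul_comm]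

/-- The Gaussian integral over the complement of a disc. -/
lemma setIntegral_gaussian_norm_ge {r : ℝ} (hr : 0 ≤ r) :
    ∫ x in {x : Plane | r ≤ ‖x‖}, Real.exp (-(Real.pi / 2) * ‖x‖ ^ 2) =
      2 * Real.exp (-(Real.pi / 2) * r ^ 2) := by
  have hm : MeasurableSet {x : Plane | r ≤ ‖x‖} := measurableSet_le measurable_const measurable_norm
  rw [← integral_indicator hm]
  have h1 : (fun x : Plane => Set.indicator {x : Plane | r ≤ ‖x‖}
      (fun x => Real.exp (-(Real.pi / 2) * ‖x‖ ^ 2)) x) = fun x : Plane =>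
      (Set.Ici r).indicator (fun y => Real.exp (-(Real.pi / 2) * y ^ 2)) ‖x‖ := by
    funext x
    simp [Set.indicator_apply]
  rw [h1, integral_fun_norm_addHaar]
  have h2 : ∫ y : ℝ in Set.Ioi 0, y ^ (Module.finrank ℝ Plane - 1) •
      (Set.Ici r).indicator (fun y => Real.exp (-(Real.pi / 2) * y ^ 2)) y =
      ∫ y : ℝ in Set.Ioi r, y * Real.exp (-(Real.pi / 2) * y ^ 2) := by
    have : ∀ y : ℝ, y ^ (Module.finrank ℝ Plane - 1) •
        (Set.Ici r).indicator (fun y => Real.exp (-(Real.pi / 2) * y ^ 2)) y =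
        (Set.Ici r).indicator (fun y => y * Real.exp (-(Real.pi / 2) * y ^ 2)) y := by
      intro y
      simp [Set.indicator_apply]
    simp_rw [this]
    rw [setIntegral_indicator measurableSet_Ici, ← integral_Ici_eq_integral_Ioi]
    rcases hr.eq_or_lt with rfl | hr
    · rw [integral_Ici_eq_integral_Ioi, Set.inter_eq_left.2 Set.Ioi_subset_Ici_self]
    · rw [Set.inter_eq_right.2 (Set.Ici_subset_Ioi.2 hr)]
  have h3 : ∫ y : ℝ in Set.Ioi r, y * Real.exp (-(Real.pi / 2) * y ^ 2) =
      Real.pi⁻¹ * Real.exp (-(Real.pi / 2) * r ^ 2) := by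
    have hint : IntegrableOn (fun y : ℝ => y * Real.exp (-(Real.pi / 2) * y ^ 2)) (Set.Ioi r) :=
      (integrable_mul_exp_neg_mul_sq (by positivity)).integrableOn
    have hd : ∀ y ∈ Set.Ici r, HasDerivAt
        (fun y : ℝ => -Real.pi⁻¹ * Real.exp (-(Real.pi / 2) * y ^ 2))
        (y * Real.exp (-(Real.pi / 2) * y ^ 2)) y := by
      intro y _
      have := (((hasDerivAt_pow 2 y).const_mul (-(Real.pi / 2))).exp).const_mul (-Real.pi⁻¹)
      refine this.congr_deriv ?_
      have := Real.pi_ne_zero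
      simp only [Nat.cast_ofNat, Nat.add_one_sub_one, pow_one]
      field_simp
    have ht : Filter.Tendsto (fun y : ℝ => -Real.pi⁻¹ * Real.exp (-(Real.pi / 2) * y ^ 2))
        Filter.atTop (nhds 0) := by
      have h0 : Filter.Tendsto (fun y : ℝ => -(Real.pi / 2) * y ^ 2) Filter.atTop Filter.atBot :=
        (Filter.tendsto_pow_atTop two_ne_zero).const_mul_atTop_of_neg
          (by linarith [Real.pi_pos])
      simpa using (Real.tendsto_exp_atBot.comp h0).const_mul (-Real.pi⁻¹)
    rw [integral_Ioi_of_hasDerivAt_of_tendsto' hd hint ht]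
    ring
  rw [h2, h3, volume_real_ball 0 zero_le_one]
  simp

/-- The mean of the Gaussian over a disc is at least `exp (-π δ² / 2)` times its value at the
centre. -/
lemma le_setIntegral_ball_gaussian (x : Plane) {δ : ℝ} (hδ : 0 ≤ δ) :
    Real.pi * δ ^ 2 * (Real.exp (-(Real.pi / 2) * δ ^ 2) * Real.exp (-(Real.pi / 2) * ‖x‖ ^ 2)) ≤
      ∫ y in Metric.ball x δ, Real.exp (-(Real.pi / 2) * ‖y‖ ^ 2) := by
  set g : Plane → ℝ := fun y => Real.exp (-(Real.pi / 2) * ‖y‖ ^ 2) with hg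
  have hgi := integrable_gaussian_plane
  -- Reflection in the centre `x` preserves the disc. Averaging `g` with its reflection turns the
  -- factor linear in `y - x` into a hyperbolic cosine, which is at least 1.
  have href : ∫ y in Metric.ball x δ, g ((x + x) - y) = ∫ y in Metric.ball x δ, g y := by
    rw [← integral_indicator Metric.isOpen_ball.measurableSet,
      ← integral_indicator Metric.isOpen_ball.measurableSet,
      ← integral_sub_left_eq_self ((Metric.ball x δ).indicator g) volume (x + x)]
    refine integral_congr_ae (Filter.Eventually.of_forall fun y => ?_)
    have : (x + x) - y ∈ Metric.ball x δ ↔ y ∈ Metric.ball x δ := by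
      rw [mem_ball_iff_norm, mem_ball_iff_norm', show x + x - y - x = x - y by abel]
    beta_reduce
    by_cases hy : y ∈ Metric.ball x δ
    · rw [Set.indicator_of_mem hy, Set.indicator_of_mem (this.2 hy)]
    · rw [Set.indicator_of_notMem hy, Set.indicator_of_notMem (this.not.2 hy)]
  have hgi' : Integrable fun y => g ((x + x) - y) := hgi.comp_sub_left (x + x)
  have hpt : ∀ y ∈ Metric.ball x δ,
      2 * (Real.exp (-(Real.pi / 2) * δ ^ 2) * Real.exp (-(Real.pi / 2) * ‖x‖ ^ 2)) ≤
        g y + g ((x + x) - y) := by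
    intro y hy
    have hyx : ‖y - x‖ ^ 2 ≤ δ ^ 2 := by
      have := (mem_ball_iff_norm.1 hy).le
      gcongr
    set u := y - x with hu
    set s : ℝ := inner ℝ x u with hs
    have h1 : ‖y‖ ^ 2 = ‖x‖ ^ 2 + 2 * s + ‖u‖ ^ 2 := by
      rw [show y = x + u by simp [hu], norm_add_sq_real]
    have h2 : ‖x + x - y‖ ^ 2 = ‖x‖ ^ 2 - 2 * s + ‖u‖ ^ 2 := by
      rw [show x + x - y = x - u by simp only [hu]; abel, norm_sub_sq_real]
    have e1 : g y = Real.exp (-(Real.pi / 2) * (‖x‖ ^ 2 + ‖u‖ ^ 2)) * Real.exp (-(Real.pi * s)) := by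
      rw [hg, ← Real.exp_add]; simp only [h1]; congr 1; ring
    have e2 : g (x + x - y) =
        Real.exp (-(Real.pi / 2) * (‖x‖ ^ 2 + ‖u‖ ^ 2)) * Real.exp (Real.pi * s) := by
      rw [hg, ← Real.exp_add]; simp only [h2]; congr 1; ring
    have e3 : Real.exp (-(Real.pi / 2) * δ ^ 2) * Real.exp (-(Real.pi / 2) * ‖x‖ ^ 2) ≤
        Real.exp (-(Real.pi / 2) * (‖x‖ ^ 2 + ‖u‖ ^ 2)) := by
      rw [← Real.exp_add, Real.exp_le_exp]
      nlinarith [Real.pi_pos]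
    have e4 : 2 ≤ Real.exp (-(Real.pi * s)) + Real.exp (Real.pi * s) := by
      linarith [Real.add_one_le_exp (Real.pi * s), Real.add_one_le_exp (-(Real.pi * s))]
    rw [e1, e2, ← mul_add]
    have := mul_le_mul e3 e4 zero_le_two (Real.exp_pos _).le
    linarith
  have hfin : volume (Metric.ball x δ) ≠ ∞ := measure_ball_lt_top.ne
  have hmono := setIntegral_mono_on (μ := volume) (integrableOn_const hfin)
    (hgi.add hgi').integrableOn Metric.isOpen_ball.measurableSet hpt
  have hadd : ∫ y in Metric.ball x δ, (g y + g ((x + x) - y)) =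
      2 * ∫ y in Metric.ball x δ, g y := by
    rw [integral_add hgi.integrableOn hgi'.integrableOn, href, two_mul]
  rw [setIntegral_const, volume_real_ball x hδ, smul_eq_mul] at hmono
  have hmono' := hmono.trans_eq hadd
  linarith

/-- A Gaussian sum over a separated set away from a disc. -/
lemma sum_gaussian_le_of_separated {ι : Type*} (F : Finset ι) (x : ι → Plane) {δ r : ℝ}
    (hδ : 0 < δ) (hr : 0 ≤ r)
    (hsep : ∀ i ∈ F, ∀ j ∈ F, i ≠ j → 2 * δ ≤ dist (x i) (x j))
    (hfar : ∀ i ∈ F, r + δ ≤ ‖x i‖) :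
    ∑ i ∈ F, Real.exp (-(Real.pi / 2) * ‖x i‖ ^ 2) ≤
      2 / (Real.pi * δ ^ 2) * Real.exp (Real.pi / 2 * δ ^ 2) *
        Real.exp (-(Real.pi / 2) * r ^ 2) := by
  have hgi := integrable_gaussian_plane
  have hdisj : (F : Set ι).Pairwise (Function.onFun Disjoint fun i => Metric.ball (x i) δ) := by
    intro i hi j hj hij
    exact Metric.ball_disjoint_ball (by linarith [hsep i hi j hj hij])
  have h1 := integral_biUnion_finset (μ := volume) F
    (f := fun y : Plane => Real.exp (-(Real.pi / 2) * ‖y‖ ^ 2))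
    (s := fun i => Metric.ball (x i) δ)
    (fun i _ => Metric.isOpen_ball.measurableSet) hdisj (fun i _ => hgi.integrableOn)
  have hsub : (⋃ i ∈ F, Metric.ball (x i) δ) ⊆ {y : Plane | r ≤ ‖y‖} := by
    intro y hy
    simp only [Set.mem_iUnion] at hy
    obtain ⟨i, hi, hy⟩ := hy
    have := mem_ball_iff_norm'.1 hy
    have h3 := norm_sub_norm_le (x i) y
    have h4 := hfar i hi
    simp only [Set.mem_ofPred_eq]
    linarith
  have h2 : ∫ y in ⋃ i ∈ F, Metric.ball (x i) δ, Real.exp (-(Real.pi / 2) * ‖y‖ ^ 2) ≤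
      2 * Real.exp (-(Real.pi / 2) * r ^ 2) := by
    rw [← setIntegral_gaussian_norm_ge hr]
    exact setIntegral_mono_set hgi.integrableOn
      (Filter.Eventually.of_forall fun y => (Real.exp_pos _).le) hsub.eventuallyLE
  rw [h1] at h2
  have h3 : ∑ i ∈ F, Real.pi * δ ^ 2 * (Real.exp (-(Real.pi / 2) * δ ^ 2) *
      Real.exp (-(Real.pi / 2) * ‖x i‖ ^ 2)) ≤ 2 * Real.exp (-(Real.pi / 2) * r ^ 2) :=
    (Finset.sum_le_sum fun i _ => le_setIntegral_ball_gaussian (x i) hδ.le).trans h2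
  rw [← Finset.mul_sum, ← Finset.mul_sum] at h3
  have hp : 0 < Real.pi * δ ^ 2 := by positivity
  have he : Real.exp (Real.pi / 2 * δ ^ 2) * Real.exp (-(Real.pi / 2) * δ ^ 2) = 1 := by
    rw [← Real.exp_add, ← Real.exp_zero]; congr 1; ring
  calc _ = (Real.exp (Real.pi / 2 * δ ^ 2) / (Real.pi * δ ^ 2)) * (Real.pi * δ ^ 2 *
        (Real.exp (-(Real.pi / 2) * δ ^ 2) *
          ∑ i ∈ F, Real.exp (-(Real.pi / 2) * ‖x i‖ ^ 2))) := by
        rw [show ∀ a b c d : ℝ, a / b * (b * (c * d)) = (a * c) * (b / b) * d from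
          fun a b c d => by ring, he, div_self hp.ne']
        ring
    _ ≤ (Real.exp (Real.pi / 2 * δ ^ 2) / (Real.pi * δ ^ 2)) *
        (2 * Real.exp (-(Real.pi / 2) * r ^ 2)) := by gcongr
    _ = _ := by ring

/-! ### The Gaussian frame over `(1/√2)ℤ²`. -/

lemma summable_exp_neg_mul_int_sub_sq {c : ℝ} (hc : 0 < c) (x : ℝ) :
    Summable fun m : ℤ => Real.exp (-c * ((m : ℝ) - x) ^ 2) := by
  have h := summable_pow_mul_jacobiTheta₂_term_bound 0
    (show 0 < c / (2 * Real.pi) by have := Real.pi_pos; positivity) 0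
  refine Summable.of_nonneg_of_le (fun _ => (Real.exp_pos _).le) (fun m => ?_)
    (h.mul_left (Real.exp (c * x ^ 2)))
  rw [pow_zero, one_mul, ← Real.exp_add, Real.exp_le_exp]
  have h1 : -Real.pi * (c / (2 * Real.pi) * (m : ℝ) ^ 2 - 2 * 0 * ↑|m|) = -(c / 2) * (m : ℝ) ^ 2 := by
    field_simp
    ring
  rw [h1]
  -- The two exponents differ by exactly `(c/2)(m - 2x)²`.
  nlinarith [mul_nonneg hc.le (sq_nonneg ((m : ℝ) - 2 * x))]

/-- The points of the lattice `(1/√2)ℤ²`. -/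
noncomputable def latticePoint (k : ℤ × ℤ) : Plane :=
  !₂[(k.1 : ℝ) * (Real.sqrt 2 / 2), (k.2 : ℝ) * (Real.sqrt 2 / 2)]

@[simp] lemma latticePoint_zero (k : ℤ × ℤ) : latticePoint k 0 = (k.1 : ℝ) * (Real.sqrt 2 / 2) := rfl

@[simp] lemma latticePoint_one (k : ℤ × ℤ) : latticePoint k 1 = (k.2 : ℝ) * (Real.sqrt 2 / 2) := rfl

lemma norm_latticePoint_sub_sq (k : ℤ × ℤ) (p : Plane) :
    ‖latticePoint k - p‖ ^ 2 =
      (((k.1 : ℝ) - Real.sqrt 2 * p 0) ^ 2 + ((k.2 : ℝ) - Real.sqrt 2 * p 1) ^ 2) / 2 := by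
  rw [plane_norm_sub_sq, latticePoint_zero, latticePoint_one]
  have h : Real.sqrt 2 ^ 2 = 2 := Real.sq_sqrt (by norm_num)
  linear_combination ((k.1 : ℝ) ^ 2 + (k.2 : ℝ) ^ 2 - 2 * (p 0) ^ 2 - 2 * (p 1) ^ 2) / 4 * h

lemma summable_gaussian_lattice (p : Plane) :
    Summable fun k : ℤ × ℤ => Real.exp (-(Real.pi / 2) * ‖latticePoint k - p‖ ^ 2) := by
  have h := (summable_exp_neg_mul_int_sub_sq (c := Real.pi / 4) (by positivity)
    (Real.sqrt 2 * p 0)).mul_of_nonneg (summable_exp_neg_mul_int_sub_sq (c := Real.pi / 4)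
    (by positivity) (Real.sqrt 2 * p 1)) (fun _ => (Real.exp_pos _).le) (fun _ => (Real.exp_pos _).le)
  refine h.congr fun k => ?_
  rw [norm_latticePoint_sub_sq, ← Real.exp_add]
  congr 1
  ring

/-- The coefficients of the Gaussian `π(p)φ` in its frame expansion. -/
noncomputable def gaussianCoeff (p : Plane) (k : ℤ × ℤ) : ℂ :=
  (starRingEnd ℂ) (gaborTransform (timeFreqShift (latticePoint k) gaussian) p)

lemma norm_gaussianCoeff (p : Plane) (k : ℤ × ℤ) :
    ‖gaussianCoeff p k‖ = Real.exp (-(Real.pi / 2) * ‖latticePoint k - p‖ ^ 2) := by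
  rw [gaussianCoeff, RCLike.norm_conj, norm_gaborTransform_timeFreqShift_gaussian]

lemma norm_timeFreqShift_gaussian_le (p : Plane) (t : ℝ) :
    ‖timeFreqShift p gaussian t‖ ≤ (2 : ℝ) ^ (1 / 4 : ℝ) := by
  rw [norm_timeFreqShift_gaussian]
  refine mul_le_of_le_one_right (by positivity) (Real.exp_le_one_iff.2 ?_)
  nlinarith [Real.pi_pos, mul_nonneg Real.pi_pos.le (sq_nonneg (t - p 0))]

/-- The modulation `e^{2πi √2 j t}`. -/
noncomputable def modulation (t : ℝ) (j : ℤ) : ℂ :=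
  Complex.exp ((2 * Real.pi * Real.sqrt 2 * j * t : ℝ) * Complex.I)

lemma norm_modulation (t : ℝ) (j : ℤ) : ‖modulation t j‖ = 1 := Complex.norm_exp_ofReal_mul_I _

lemma modulation_add (t : ℝ) (j k : ℤ) : modulation t (j + k) = modulation t j * modulation t k := by
  rw [modulation, modulation, modulation, ← Complex.exp_add]
  congr 1
  push_cast
  ring

lemma modulation_zero (t : ℝ) : modulation t 0 = 1 := by simp [modulation]

lemma sqrt_two_sq_complex : ((Real.sqrt 2 : ℝ) : ℂ) ^ 2 = 2 := by
  rw [← Complex.ofReal_pow, Real.sq_sqrt (by norm_num)]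
  norm_num

/-- Modulations by `√2j` commute with translations by `√2k`, since `√2 · √2` is an integer. Hence
the theta series is unaffected by the translations and the two factors of the frame operator can be
inverted separately. -/
lemma modulation_sub_sqrt_two_mul (t : ℝ) (j k : ℤ) :
    modulation (t - Real.sqrt 2 * k) j = modulation t j := by
  rw [modulation, modulation, Complex.exp_eq_exp_iff_exists_int]
  refine ⟨-(2 * j * k), ?_⟩
  push_cast
  linear_combination (-2 * Real.pi * j * k * Complex.I : ℂ) * sqrt_two_sq_complex

/-- The periodised Gaussian is the theta series with coefficients `exp (-π j²)`. -/
lemma tsum_exp_neg_pi_sub_sq (s : ℝ) :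
    ∑' m : ℤ, Complex.exp (-Real.pi * ((m : ℂ) - Real.sqrt 2 * s) ^ 2) =
      ∑' j, (thetaCoeff j : ℂ) * modulation s j := by
  have h := Complex.tsum_exp_neg_quadratic (a := 1) (by simp) (Complex.I * (Real.sqrt 2 * s))
  rw [Complex.one_cpow, div_one, one_mul] at h
  calc _ = ∑' n : ℤ, Complex.exp (-Real.pi / 1 * (n + Complex.I * (Complex.I * (Real.sqrt 2 * s))) ^ 2) := by
        refine tsum_congr fun n => ?_
        rw [← mul_assoc Complex.I, Complex.I_mul_I, div_one]
        congr 2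
        ring
    _ = _ := h.symm
    _ = _ := by
        refine tsum_congr fun j => ?_
        rw [thetaCoeff, modulation, Complex.ofReal_exp, ← Complex.exp_add]
        congr 1
        push_cast
        ring

/-- Poisson summation in the frequency index `n` for a fixed time index `m`. The quadratic term in
`n` has parameter `1/4`, whence the factor `2 = (1/4)^(-1/2)`. -/
lemma tsum_gaussianCoeff_row (p : Plane) (s : ℝ) (m : ℤ) :
    ∑' n : ℤ, gaussianCoeff p (m, n) * timeFreqShift (latticePoint (m, n)) gaussian s =
      ∑' k : ℤ, 2 * Complex.exp (-Real.pi * (((m + k : ℤ) : ℂ) - Real.sqrt 2 * s) ^ 2) *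
        ((thetaCoeff k : ℂ) * timeFreqShift p gaussian (s - Real.sqrt 2 * k)) := by
  set q : ℂ := ((Real.sqrt 2 : ℝ) : ℂ) with hq
  have hq2 : q ^ 2 = 2 := sqrt_two_sq_complex
  have hI : Complex.I ^ 2 = -1 := Complex.I_sq
  -- Completing the exponent as a quadratic polynomial in `n`: `b` carries the linear term, and `c`
  -- below everything independent of `n`.
  set b : ℂ := q / 4 * (p 1 - Complex.I * (m * (q / 2) + p 0) + 2 * Complex.I * s) with hb
  set c : ℂ := (((2 : ℝ) ^ (1 / 4 : ℝ) : ℝ) : ℂ) *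
    Complex.exp (-(Real.pi / 2) * ((m * (q / 2) - p 0) ^ 2 + (p 1 : ℂ) ^ 2)
      + Real.pi * Complex.I * p 1 * (m * (q / 2) + p 0) - Real.pi * (s - m * (q / 2)) ^ 2) with hc
  have h := Complex.tsum_exp_neg_quadratic (a := ((1 / 4 : ℝ) : ℂ)) (by simp) b
  have h4 : 1 / ((1 / 4 : ℝ) : ℂ) ^ (1 / 2 : ℂ) = 2 := by
    rw [show (1 / 2 : ℂ) = ((1 / 2 : ℝ) : ℂ) by norm_num, ← Complex.ofReal_cpow (by norm_num),
      ← Real.sqrt_eq_rpow, show (1 / 4 : ℝ) = (1 / 2) ^ 2 by norm_num, Real.sqrt_sq (by norm_num)]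
    norm_num
  rw [h4] at h
  calc _ = ∑' n : ℤ, c * Complex.exp (-Real.pi * ((1 / 4 : ℝ) : ℂ) * n ^ 2 + 2 * Real.pi * b * n) := by
        refine tsum_congr fun n => ?_
        rw [gaussianCoeff, gaborTransform_timeFreqShift_gaussian, ← Complex.exp_conj, timeFreqShift,
          gaussian_eq_cexp, mul_left_comm _ _ (Complex.exp _), mul_left_comm, hc,
          mul_assoc (((2 : ℝ) ^ (1 / 4 : ℝ) : ℝ) : ℂ) (Complex.exp _), ← Complex.exp_add,
          ← Complex.exp_add, ← Complex.exp_add]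
        congr 2
        simp only [map_add, map_mul, map_neg, map_pow, map_sub, Complex.conj_ofReal,
          Complex.conj_I, map_div₀, map_ofNat, latticePoint_zero, latticePoint_one]
        rw [hb]
        push_cast
        rw [← hq]
        grind
    _ = ∑' k : ℤ, c * (2 * Complex.exp (-Real.pi / ((1 / 4 : ℝ) : ℂ) * (k + Complex.I * b) ^ 2)) := by
        rw [tsum_mul_left, h, tsum_mul_left, tsum_mul_left]
    _ = _ := by
        refine tsum_congr fun k => ?_
        rw [thetaCoeff, timeFreqShift, gaussian_eq_cexp, hc, Complex.ofReal_exp]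
        rw [show ∀ x y z : ℂ, x * y * (2 * z) = 2 * x * (y * z) from fun x y z => by ring,
          show ∀ x y z w a : ℂ, 2 * x * (y * (z * (a * w))) = 2 * a * (x * y * z * w) from
            fun x y z w a => by ring, ← Complex.exp_add, ← Complex.exp_add, ← Complex.exp_add,
            ← Complex.exp_add]
        congr 2
        rw [hb]
        push_cast
        rw [← hq]
        grind

/-- Janssen's representation of the frame operator of the Gaussian over `(1/√2)ℤ²`, applied to a
Gaussian. -/
lemma tsum_gaussianCoeff_mul (p : Plane) (s : ℝ) :
    ∑' x : ℤ × ℤ, gaussianCoeff p x * timeFreqShift (latticePoint x) gaussian s =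
      2 * (∑' j, (thetaCoeff j : ℂ) * modulation s j) *
        ∑' k : ℤ, (thetaCoeff k : ℂ) * timeFreqShift p gaussian (s - Real.sqrt 2 * k) := by
  have hs : Summable fun x : ℤ × ℤ =>
      gaussianCoeff p x * timeFreqShift (latticePoint x) gaussian s := by
    refine Summable.of_norm_bounded ((summable_gaussian_lattice p).mul_right
      ((2 : ℝ) ^ (1 / 4 : ℝ))) fun x => ?_
    rw [norm_mul, norm_gaussianCoeff]
    exact mul_le_mul_of_nonneg_left (norm_timeFreqShift_gaussian_le _ s) (Real.exp_pos _).le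
  set g : ℤ → ℂ := fun m => 2 * Complex.exp (-Real.pi * ((m : ℂ) - Real.sqrt 2 * s) ^ 2) with hg
  set h : ℤ → ℂ := fun k => (thetaCoeff k : ℂ) * timeFreqShift p gaussian (s - Real.sqrt 2 * k)
    with hh
  have hgs : Summable fun m => ‖g m‖ := by
    refine ((summable_exp_neg_mul_int_sub_sq Real.pi_pos (Real.sqrt 2 * s)).mul_left 2).congr
      fun m => ?_
    rw [hg, norm_mul, Complex.norm_ofNat, Complex.norm_exp,
      show (-Real.pi * ((m : ℂ) - Real.sqrt 2 * s) ^ 2) =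
        ((-Real.pi * ((m : ℝ) - Real.sqrt 2 * s) ^ 2 : ℝ) : ℂ) by push_cast; ring,
      Complex.ofReal_re]
  have hhs : Summable fun k => ‖h k‖ := by
    refine Summable.of_nonneg_of_le (fun _ => norm_nonneg _) (fun k => ?_)
      (summable_thetaCoeff.mul_right ((2 : ℝ) ^ (1 / 4 : ℝ)))
    rw [hh, norm_mul, Complex.norm_real, Real.norm_of_nonneg (thetaCoeff_nonneg k)]
    exact mul_le_mul_of_nonneg_left (norm_timeFreqShift_gaussian_le _ _) (thetaCoeff_nonneg k)
  have hprod : Summable fun x : ℤ × ℤ => g x.1 * h x.2 := summable_mul_of_summable_norm hgs hhs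
  -- The shear `(m, k) ↦ (m + k, k)` decouples the double sum into a product of two single sums.
  have hF : Summable fun x : ℤ × ℤ => g (x.1 + x.2) * h x.2 := shearEquiv.symm.summable_iff.2 hprod
  calc _ = ∑' m : ℤ, ∑' n : ℤ, gaussianCoeff p (m, n) *
        timeFreqShift (latticePoint (m, n)) gaussian s := hs.tsum_prod
    _ = ∑' m : ℤ, ∑' k : ℤ, g (m + k) * h k := tsum_congr fun m => tsum_gaussianCoeff_row p s m
    _ = ∑' x : ℤ × ℤ, g (x.1 + x.2) * h x.2 := hF.tsum_prod.symm
    _ = ∑' x : ℤ × ℤ, g x.1 * h x.2 := shearEquiv.symm.tsum_eq fun x : ℤ × ℤ => g x.1 * h x.2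
    _ = (∑' m, g m) * ∑' k, h k := (tsum_mul_tsum_of_summable_norm hgs hhs).symm
    _ = _ := by rw [hg, tsum_mul_left, tsum_exp_neg_pi_sub_sq]

/-- The lattice translation by `2(k, j)`, for `i = (j, k)`. -/
def doubleShift (i x : ℤ × ℤ) : ℤ × ℤ := (x.1 + 2 * i.2, x.2 + 2 * i.1)

/-- Shifts by `√2ℤ²` stay inside `(1/√2)ℤ²`, and the phase produced by composing them with a lattice
shift is `exp(2πi · integer) = 1`. Inverting the frame operator therefore only mixes lattice
Gaussians. -/
lemma timeFreqShift_doubleShift (i x : ℤ × ℤ) (t : ℝ) :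
    timeFreqShift (latticePoint (doubleShift i x)) gaussian t =
      modulation t i.1 * timeFreqShift (latticePoint x) gaussian (t - Real.sqrt 2 * i.2) := by
  rw [timeFreqShift, timeFreqShift, ← mul_assoc]
  congr 1
  · rw [modulation, ← Complex.exp_add, Complex.exp_eq_exp_iff_exists_int]
    refine ⟨x.2 * i.2, ?_⟩
    simp only [latticePoint_one, doubleShift]
    push_cast
    linear_combination (Real.pi * Complex.I * x.2 * i.2 : ℂ) * sqrt_two_sq_complex
  · congr 1
    simp only [latticePoint_zero, doubleShift]
    push_cast
    ring

lemma summable_frameFamily {b : ℤ → ℝ} (hb : Summable fun m => |b m|) (p : Plane) :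
    Summable fun y : (ℤ × ℤ) × (ℤ × ℤ) =>
      ‖(1 / 2 * (b y.1.1 * b y.1.2) : ℂ) * gaussianCoeff p y.2‖ := by
  have h1 : Summable fun i : ℤ × ℤ => 1 / 2 * (|b i.1| * |b i.2|) :=
    (hb.mul_of_nonneg hb (fun _ => abs_nonneg _) (fun _ => abs_nonneg _)).mul_left _
  refine (h1.mul_of_nonneg (summable_gaussian_lattice p)
    (fun i => by positivity) fun _ => (Real.exp_pos _).le).congr fun y => ?_
  rw [norm_mul, norm_gaussianCoeff, norm_mul, norm_mul, Complex.norm_real, Complex.norm_real]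
  simp

/-- The Gaussian frame over `(1/√2)ℤ²` reproduces the time-frequency shifts of the Gaussian. -/
lemma tsum_frameFamily {b : ℤ → ℝ} (hb : Summable fun m => |b m|)
    (hinv : ∀ (u : ℤ → ℂ) (B : ℝ), (∀ m, ‖u m‖ ≤ B) →
        ∑' m, (b m : ℂ) * ∑' k, (thetaCoeff k : ℂ) * u (m + k) = u 0) (p : Plane) (t : ℝ) :
    ∑' y : (ℤ × ℤ) × (ℤ × ℤ), (1 / 2 * (b y.1.1 * b y.1.2) : ℂ) * gaussianCoeff p y.2 *
        timeFreqShift (latticePoint (doubleShift y.1 y.2)) gaussian t =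
      timeFreqShift p gaussian t := by
  have hs : Summable fun y : (ℤ × ℤ) × (ℤ × ℤ) =>
      (1 / 2 * (b y.1.1 * b y.1.2) : ℂ) * gaussianCoeff p y.2 *
        timeFreqShift (latticePoint (doubleShift y.1 y.2)) gaussian t := by
    refine Summable.of_norm_bounded ((summable_frameFamily hb p).mul_right
      ((2 : ℝ) ^ (1 / 4 : ℝ))) fun x => ?_
    rw [norm_mul]
    exact mul_le_mul_of_nonneg_left (norm_timeFreqShift_gaussian_le _ t) (norm_nonneg _)
  set W : ℂ := ∑' j, (thetaCoeff j : ℂ) * modulation t j with hW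
  set v : ℤ → ℂ := fun k => timeFreqShift p gaussian (t - Real.sqrt 2 * k) with hv
  have hvb : ∀ m, ‖v m‖ ≤ (2 : ℝ) ^ (1 / 4 : ℝ) := fun m => norm_timeFreqShift_gaussian_le _ _
  -- The Fourier series with coefficients `b` is the pointwise reciprocal of the theta series `W`;
  -- `h2` is the corresponding inversion of the convolution factor.
  have h1 : ∑' j, (b j : ℂ) * (modulation t j * W) = 1 := by
    rw [← modulation_zero t, ← hinv (modulation t) 1 fun m => (norm_modulation t m).le]
    refine tsum_congr fun j => ?_
    rw [hW, ← tsum_mul_left]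
    congr 1
    exact tsum_congr fun k => by rw [modulation_add]; ring
  have h2 : ∑' k, (b k : ℂ) * ∑' l, (thetaCoeff l : ℂ) * v (k + l) = timeFreqShift p gaussian t := by
    rw [hinv v _ hvb, hv]
    simp
  have hn1 : Summable fun j => ‖(b j : ℂ) * (modulation t j * W)‖ := by
    refine (hb.mul_right ‖W‖).congr fun j => ?_
    rw [norm_mul, norm_mul, norm_modulation, one_mul, Complex.norm_real, Real.norm_eq_abs]
  have hn2 : Summable fun k => ‖(b k : ℂ) * ∑' l, (thetaCoeff l : ℂ) * v (k + l)‖ := by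
    refine Summable.of_nonneg_of_le (fun _ => norm_nonneg _) (fun k => ?_)
      (hb.mul_right ((∑' l, thetaCoeff l) * (2 : ℝ) ^ (1 / 4 : ℝ)))
    rw [norm_mul, Complex.norm_real, Real.norm_eq_abs]
    refine mul_le_mul_of_nonneg_left ?_ (abs_nonneg _)
    refine tsum_of_norm_bounded (summable_thetaCoeff.hasSum.mul_right _) fun l => ?_
    rw [norm_mul, Complex.norm_real, Real.norm_of_nonneg (thetaCoeff_nonneg l)]
    exact mul_le_mul_of_nonneg_left (hvb _) (thetaCoeff_nonneg l)
  calc _ = ∑' i : ℤ × ℤ, ∑' x : ℤ × ℤ, (1 / 2 * (b i.1 * b i.2) : ℂ) * gaussianCoeff p x *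
        timeFreqShift (latticePoint (doubleShift i x)) gaussian t := hs.tsum_prod
    _ = ∑' i : ℤ × ℤ, ((b i.1 : ℂ) * (modulation t i.1 * W)) *
        ((b i.2 : ℂ) * ∑' l, (thetaCoeff l : ℂ) * v (i.2 + l)) := by
        refine tsum_congr fun i => ?_
        have h := tsum_gaussianCoeff_mul p (t - Real.sqrt 2 * i.2)
        simp only [modulation_sub_sqrt_two_mul] at h
        have hvl : ∀ l : ℤ, timeFreqShift p gaussian (t - Real.sqrt 2 * i.2 - Real.sqrt 2 * l) =
            v (i.2 + l) := by
          intro l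
          rw [hv]
          congr 1
          push_cast
          ring
        simp only [hvl] at h
        rw [← hW] at h
        calc _ = ∑' x : ℤ × ℤ, (1 / 2 * (b i.1 * b i.2) * modulation t i.1 : ℂ) * (gaussianCoeff p x *
              timeFreqShift (latticePoint x) gaussian (t - Real.sqrt 2 * i.2)) :=
              tsum_congr fun x => by rw [timeFreqShift_doubleShift]; ring
          _ = _ := by rw [tsum_mul_left, h]; ring
    _ = _ := by rw [← tsum_mul_tsum_of_summable_norm hn1 hn2, h1, h2, one_mul]

/-! ### The expansion of `𝒢f` with bounded coefficients. -/

/-- A frame expansion of the Gabor transform, with coefficients bounded by its supremum. -/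
lemma exists_gabor_expansion {f : ℝ → ℂ} (hf : MemLp f 2) :
    ∃ c : ℤ × ℤ → ℂ, (∀ x, ‖c x‖ ≤ 8 / 9 * Real.sqrt (spectrogramSup f)) ∧
      ∀ p, HasSum (fun x => c x * gaborTransform (timeFreqShift (latticePoint x) gaussian) p)
        (gaborTransform f p) := by
  obtain ⟨b, hb, hb1, hinv⟩ := exists_inverse_thetaCoeff
  set S := Real.sqrt (spectrogramSup f)
  have hS : 0 ≤ S := Real.sqrt_nonneg _
  have hbb : HasSum (fun i : ℤ × ℤ => |b i.1| * |b i.2|) ((∑' m, |b m|) * ∑' m, |b m|) :=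
    hb.hasSum.mul hb.hasSum (hb.mul_of_nonneg hb (fun _ => abs_nonneg _) (fun _ => abs_nonneg _))
  refine ⟨fun x => ∑' i : ℤ × ℤ, (1 / 2 * (b i.1 * b i.2) : ℂ) *
    gaborTransform f (latticePoint (doubleShift i x)), fun x => ?_, fun p => ?_⟩
  · have h := tsum_of_norm_bounded (f := fun i : ℤ × ℤ => (1 / 2 * (b i.1 * b i.2) : ℂ) *
      gaborTransform f (latticePoint (doubleShift i x))) ((hbb.mul_left (1 / 2)).mul_right S)
      fun i => by
        rw [norm_mul, norm_mul, norm_mul, Complex.norm_real, Complex.norm_real, Real.norm_eq_abs,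
          Real.norm_eq_abs]
        simp only [one_div, norm_inv, Complex.norm_ofNat]
        exact mul_le_mul_of_nonneg_left (norm_gaborTransform_le hf _) (by positivity)
    refine h.trans (mul_le_mul_of_nonneg_right ?_ hS)
    have h0 : 0 ≤ ∑' m, |b m| := tsum_nonneg fun _ => abs_nonneg _
    -- `½ · (4/3)² = 8/9`.
    nlinarith
  · obtain ⟨M, hM0, hM⟩ := exists_integral_norm_mul_conj_timeFreqShift_le hf
    set d : (ℤ × ℤ) × (ℤ × ℤ) → ℂ := fun y =>
      (1 / 2 * (b y.1.1 * b y.1.2) : ℂ) * gaussianCoeff p y.2 with hd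
    set F : (ℤ × ℤ) × (ℤ × ℤ) → ℝ → ℂ := fun y t => (starRingEnd ℂ) (d y) *
      (f t * (starRingEnd ℂ) (timeFreqShift (latticePoint (doubleShift y.1 y.2)) gaussian t)) with hF
    have hint : ∀ y, Integrable (F y) := fun y =>
      (integrable_mul_conj_timeFreqShift hf _).const_mul _
    have hsum : Summable fun y => ∫ t, ‖F y t‖ := by
      refine Summable.of_nonneg_of_le (fun y => integral_nonneg fun _ => norm_nonneg _) (fun y => ?_)
        ((summable_frameFamily hb p).mul_right M)
      simp only [hF, norm_mul (starRingEnd ℂ (d y)), RCLike.norm_conj]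
      rw [integral_const_mul]
      exact mul_le_mul_of_nonneg_left (hM _) (norm_nonneg _)
    have hkey := hasSum_integral_of_summable_integral_norm hint hsum
    -- Pairing `f` with the reproducing formula for `π(p)φ` transfers the expansion from Gaussians
    -- to `f`.
    have hlim : ∫ t, ∑' y, F y t = gaborTransform f p := by
      refine integral_congr_ae (Filter.Eventually.of_forall fun t => ?_)
      beta_reduce
      rw [← tsum_frameFamily hb hinv p t, Complex.conj_tsum, ← tsum_mul_left]
      refine tsum_congr fun y => ?_
      simp only [hF, hd, map_mul]
      ring
    rw [hlim] at hkey
    have hval : ∀ y, ∫ t, F y t = (1 / 2 * (b y.1.1 * b y.1.2) : ℂ) *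
        gaborTransform f (latticePoint (doubleShift y.1 y.2)) *
        gaborTransform (timeFreqShift (latticePoint y.2) gaussian) p := by
      intro y
      simp only [hF]
      rw [integral_const_mul, ← gaborTransform, hd]
      simp only [gaussianCoeff, map_mul, Complex.conj_conj, Complex.conj_ofReal, map_div₀, map_one,
        map_ofNat]
      ring
    simp only [hval] at hkey
    -- Summing over the shift index first collects the coefficient of each lattice Gaussian.
    have hkey2 := (Equiv.prodComm (ℤ × ℤ) (ℤ × ℤ)).hasSum_iff.2 hkey
    have h := hkey2.prod_fiberwise fun x => (hkey2.summable.prod_factor x).hasSum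
    simp only [Function.comp_apply, Equiv.prodComm_apply, Prod.swap_prod_mk, tsum_mul_right] at h
    exact h

/-! ### Truncation of the expansion to `Γ`. -/

lemma dist_latticePoint_sq (j k : ℤ × ℤ) :
    dist (latticePoint j) (latticePoint k) ^ 2 =
      (((j.1 - k.1 : ℤ) : ℝ) ^ 2 + ((j.2 - k.2 : ℤ) : ℝ) ^ 2) / 2 := by
  rw [dist_eq_norm, norm_latticePoint_sub_sq, latticePoint_zero, latticePoint_one]
  have h : Real.sqrt 2 * Real.sqrt 2 = 2 := Real.mul_self_sqrt (by norm_num)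
  rw [show ∀ a : ℝ, Real.sqrt 2 * (a * (Real.sqrt 2 / 2)) = a * (Real.sqrt 2 * Real.sqrt 2) / 2 from
    fun a => by ring, show ∀ a : ℝ, Real.sqrt 2 * (a * (Real.sqrt 2 / 2)) =
      a * (Real.sqrt 2 * Real.sqrt 2) / 2 from fun a => by ring, h]
  push_cast
  ring

/-- Distinct lattice points are at least `1/√2` apart, so discs of radius `δ = 1/(2√2)` are
disjoint. This `δ` is the additive term in the distance hypothesis. -/
lemma le_dist_latticePoint {j k : ℤ × ℤ} (h : j ≠ k) :
    2 * (1 / (2 * Real.sqrt 2)) ≤ dist (latticePoint j) (latticePoint k) := by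
  refine (sq_le_sq₀ (by positivity) dist_nonneg).1 ?_
  rw [dist_latticePoint_sq]
  have h2 : (2 * (1 / (2 * Real.sqrt 2))) ^ 2 = 1 / 2 := by
    have : Real.sqrt 2 ^ 2 = 2 := Real.sq_sqrt (by norm_num)
    field_simp
    linarith
  rw [h2]
  have h3 : (1 : ℤ) ≤ (j.1 - k.1) ^ 2 + (j.2 - k.2) ^ 2 := by
    by_contra hlt
    have h1 := sq_nonneg (j.1 - k.1)
    have h2 := sq_nonneg (j.2 - k.2)
    have e1 : j.1 - k.1 = 0 := pow_eq_zero_iff two_ne_zero |>.1 (by omega)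
    have e2 : j.2 - k.2 = 0 := pow_eq_zero_iff two_ne_zero |>.1 (by omega)
    exact h (Prod.ext (by omega) (by omega))
  have h4 : (1 : ℝ) ≤ ((j.1 - k.1 : ℤ) : ℝ) ^ 2 + ((j.2 - k.2 : ℤ) : ℝ) ^ 2 := by exact_mod_cast h3
  linarith

lemma latticePoint_injective : Function.Injective latticePoint := by
  intro j k hjk
  by_contra h
  have h1 := le_dist_latticePoint h
  rw [hjk, dist_self] at h1
  have : 0 < 2 * (1 / (2 * Real.sqrt 2)) := by positivity
  linarith

lemma range_latticePoint : Set.range latticePoint = squareLattice (1 / Real.sqrt 2) := by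
  have h : 1 / Real.sqrt 2 = Real.sqrt 2 / 2 := by
    have : Real.sqrt 2 * Real.sqrt 2 = 2 := Real.mul_self_sqrt (by norm_num)
    field_simp
    linarith
  rw [h]
  ext q
  constructor
  · rintro ⟨k, rfl⟩
    refine ⟨![k.1, k.2], fun i => ?_⟩
    fin_cases i
    · simp [mul_comm]
    · simp [mul_comm]
  · rintro ⟨k, hk⟩
    refine ⟨(k 0, k 1), ?_⟩
    ext i
    fin_cases i
    · simp [hk, mul_comm]
    · simp [hk, mul_comm]

/-- The Gaussian tail over the lattice `(1/√2)ℤ²`. -/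
lemma sum_gaussian_lattice_le (F : Finset (ℤ × ℤ)) (p : Plane) {r : ℝ} (hr : 0 ≤ r)
    (hfar : ∀ k ∈ F, r + 1 / (2 * Real.sqrt 2) ≤ dist p (latticePoint k)) :
    ∑ k ∈ F, Real.exp (-(Real.pi / 2) * ‖latticePoint k - p‖ ^ 2) ≤
      6.5 * Real.exp (-(Real.pi / 2) * r ^ 2) := by
  have hδ : 0 < 1 / (2 * Real.sqrt 2) := by positivity
  refine (sum_gaussian_le_of_separated F (fun k => latticePoint k - p) hδ hr
    (fun j _ k _ hjk => ?_) fun k hk => ?_).trans ?_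
  · rw [dist_sub_right]
    exact le_dist_latticePoint hjk
  · rw [← dist_eq_norm, dist_comm]
    exact hfar k hk
  · refine mul_le_mul_of_nonneg_right ?_ (Real.exp_pos _).le
    have h2 : (1 / (2 * Real.sqrt 2)) ^ 2 = 1 / 8 := by
      have : Real.sqrt 2 ^ 2 = 2 := Real.sq_sqrt (by norm_num)
      rw [div_pow, mul_pow, this]
      norm_num
    rw [h2]
    have hpi := Real.pi_gt_d2
    have hpi' := Real.pi_lt_d2
    have he : Real.exp (Real.pi / 2 * (1 / 8)) ≤ 5 / 4 := by
      have h := Real.one_sub_le_exp_neg (Real.pi / 2 * (1 / 8))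
      have h3 : (4 / 5 : ℝ) ≤ Real.exp (-(Real.pi / 2 * (1 / 8))) := by linarith
      rw [Real.exp_neg] at h3
      have := inv_anti₀ (by norm_num) h3
      rw [inv_inv] at this
      linarith
    have h4 : 2 / (Real.pi * (1 / 8)) ≤ 5.2 := by
      rw [div_le_iff₀ (by positivity)]
      linarith
    -- With `δ² = 1/8` the constant is `(16/π) exp(π/16)`.
    calc _ ≤ 5.2 * (5 / 4 : ℝ) := mul_le_mul h4 he (Real.exp_pos _).le (by norm_num)
      _ = 6.5 := by norm_num

/-- Truncated frame expansion: bounded coefficients, with a Gaussian error at points away from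
the missing lattice points. -/
lemma exists_truncated_gabor_expansion {f : ℝ → ℂ} (hf : MemLp f 2) :
    ∃ c : Plane → ℂ, (∀ q ∈ squareLattice (1 / Real.sqrt 2),
        ‖c q‖ ≤ 8 / 9 * Real.sqrt (spectrogramSup f)) ∧
      ∀ Γ : Finset Plane, (Γ : Set Plane) ⊆ squareLattice (1 / Real.sqrt 2) →
        ∀ (p : Plane) (r : ℝ), 0 ≤ r →
        (∀ q ∈ squareLattice (1 / Real.sqrt 2) \ (Γ : Set Plane),
          r + 1 / (2 * Real.sqrt 2) ≤ dist p q) →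
        ‖gaborTransform f p - ∑ l : Γ, c l * evalVector Γ p l‖ ≤
          8 / 9 * Real.sqrt (spectrogramSup f) * (6.5 * Real.exp (-(Real.pi / 2) * r ^ 2)) := by
  obtain ⟨c, hc, hexp⟩ := exists_gabor_expansion hf
  have hinv : ∀ k, Function.invFun latticePoint (latticePoint k) = k :=
    Function.leftInverse_invFun latticePoint_injective
  set S := Real.sqrt (spectrogramSup f)
  have hS : 0 ≤ S := Real.sqrt_nonneg _
  -- Indexing the coefficients by points of the plane makes them independent of `Γ`; values off the
  -- lattice are irrelevant.
  refine ⟨fun q => c (Function.invFun latticePoint q), fun q _ => hc _, fun Γ hΓ p r hr hfar => ?_⟩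
  set G : Plane → ℂ := fun q => c (Function.invFun latticePoint q) *
    gaborTransform (timeFreqShift q gaussian) p with hG
  set F : Finset (ℤ × ℤ) := Γ.preimage latticePoint latticePoint_injective.injOn with hF
  have hsum : ∑ l : Γ, c (Function.invFun latticePoint (l : Plane)) * evalVector Γ p l =
      ∑ k ∈ F, G (latticePoint k) := by
    rw [hF, Finset.sum_preimage]
    · exact Finset.sum_coe_sort Γ G
    · intro q hq hq'
      rw [range_latticePoint] at hq'
      exact absurd (hΓ hq) hq'
  have hGexp : HasSum (fun k => G (latticePoint k)) (gaborTransform f p) := by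
    simp only [hG, hinv]
    exact hexp p
  have htail : HasSum (fun k : {k // k ∉ F} => G (latticePoint k))
      (gaborTransform f p - ∑ k ∈ F, G (latticePoint k)) := by
    refine (Finset.hasSum_compl_iff (f := fun k => G (latticePoint k)) F).2 ?_
    rwa [sub_add_cancel]
  rw [hsum, ← htail.tsum_eq]
  have hsm : Summable fun k : {k // k ∉ F} =>
      Real.exp (-(Real.pi / 2) * ‖latticePoint (k : ℤ × ℤ) - p‖ ^ 2) :=
    (summable_gaussian_lattice p).subtype _
  refine (tsum_of_norm_bounded (hsm.hasSum.mul_left (8 / 9 * S)) fun k => ?_).trans ?_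
  · rw [hG, norm_mul, norm_gaborTransform_timeFreqShift_gaussian]
    exact mul_le_mul_of_nonneg_right (hc _) (Real.exp_pos _).le
  · refine mul_le_mul_of_nonneg_left (hsm.tsum_le_of_sum_le fun s => ?_) (by positivity)
    have h := sum_gaussian_lattice_le (s.map (Function.Embedding.subtype _)) p hr fun k hk => ?_
    · rw [Finset.sum_map] at h
      exact h
    · simp only [Finset.mem_map, Function.Embedding.subtype_apply] at hk
      obtain ⟨k', -, rfl⟩ := hk
      refine hfar _ ⟨range_latticePoint ▸ Set.mem_range_self _, fun hmem => k'.2 ?_⟩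
      exact Finset.mem_preimage.2 hmem

/-! ### The admissible rank one matrices. -/

lemma abs_norm_sq_sub_norm_sq_le {z w : ℂ} {S E : ℝ} (hz : ‖z‖ ≤ S) (hzw : ‖z - w‖ ≤ E) :
    |‖w‖ ^ 2 - ‖z‖ ^ 2| ≤ E * (2 * S + E) := by
  have h1 : |‖w‖ - ‖z‖| ≤ E := by
    rw [abs_sub_comm]
    exact (abs_norm_sub_norm_le z w).trans hzw
  have h2 : ‖w‖ + ‖z‖ ≤ 2 * S + E := by linarith [abs_le.1 h1]
  rw [show ‖w‖ ^ 2 - ‖z‖ ^ 2 = (‖w‖ - ‖z‖) * (‖w‖ + ‖z‖) by ring, abs_mul,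
    abs_of_nonneg (by positivity : 0 ≤ ‖w‖ + ‖z‖)]
  exact mul_le_mul h1 h2 (by positivity) ((abs_nonneg _).trans h1)

/-- Bounded coefficients whose rank one matrices are admissible. -/
lemma exists_admissible_vector {f : ℝ → ℂ} (hf : MemLp f 2) {ε : ℝ} (hε : 0 < ε)
    (Ω : Set Plane) (Γ : Finset Plane) (hΓ : (Γ : Set Plane) ⊆ squareLattice (1 / Real.sqrt 2))
    (hdist : ENNReal.ofReal
        (Real.sqrt (2 / Real.pi * Real.log (53 * spectrogramSup f / ε)) + 1 / (2 * Real.sqrt 2))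
      ≤ setDist Ω (squareLattice (1 / Real.sqrt 2) \ (Γ : Set Plane))) :
    ∃ c : Γ → ℂ, (∀ l, ‖c l‖ ^ 2 ≤ 1.6 * spectrogramSup f) ∧
      ∀ p ∈ Ω, |‖∑ l, c l * evalVector Γ p l‖ ^ 2 - spectrogram f p| ≤ ε := by
  have hN := spectrogramSup_nonneg f
  set N := spectrogramSup f with hNdef
  -- If `N ≤ ε`, zero coefficients already meet the constraints. Otherwise `53N/ε > 1`, so the
  -- logarithm is nonnegative and the square root is not cut off at `0`.
  rcases le_or_gt N ε with hle | hlt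
  · refine ⟨0, fun l => ?_, fun p _ => ?_⟩
    · simp only [Pi.zero_apply, norm_zero]
      linarith
    · simp only [Pi.zero_apply, zero_mul, Finset.sum_const_zero, norm_zero]
      rw [zero_pow two_ne_zero, zero_sub, abs_neg, abs_of_nonneg (by unfold spectrogram; positivity)]
      exact (spectrogram_le_spectrogramSup hf p).trans hle
  obtain ⟨c, hc, htrunc⟩ := exists_truncated_gabor_expansion hf
  have hNpos : 0 < N := hε.trans hlt
  have hSsq : Real.sqrt N ^ 2 = N := Real.sq_sqrt hN
  refine ⟨fun l => c l, fun l => ?_, fun p hp => ?_⟩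
  · have h := hc l (hΓ l.2)
    calc ‖c l‖ ^ 2 ≤ (8 / 9 * Real.sqrt N) ^ 2 := by gcongr
      _ ≤ 1.6 * N := by rw [mul_pow, hSsq]; linarith
  · set r := Real.sqrt (2 / Real.pi * Real.log (53 * N / ε)) with hr
    have hr0 : 0 ≤ r := Real.sqrt_nonneg _
    have hpos : 0 < 53 * N / ε := by positivity
    have hlog : 0 ≤ Real.log (53 * N / ε) := by
      refine Real.log_nonneg ?_
      rw [le_div_iff₀ hε]
      linarith
    have hQ : Real.exp (-(Real.pi / 2) * r ^ 2) = (53 * N / ε)⁻¹ := by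
      rw [hr, Real.sq_sqrt (by positivity), ← Real.exp_log (inv_pos.2 hpos), Real.log_inv]
      congr 1
      field_simp
    have hfar : ∀ q ∈ squareLattice (1 / Real.sqrt 2) \ (Γ : Set Plane),
        r + 1 / (2 * Real.sqrt 2) ≤ dist p q := by
      intro q hq
      have h : ENNReal.ofReal (r + 1 / (2 * Real.sqrt 2)) ≤ edist p q :=
        hdist.trans ((iInf₂_le p hp).trans (iInf₂_le q hq))
      rw [edist_dist] at h
      exact (ENNReal.ofReal_le_ofReal_iff dist_nonneg).1 h
    have h := htrunc Γ hΓ p r hr0 hfar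
    refine (abs_norm_sq_sub_norm_sq_le (norm_gaborTransform_le hf p) h).trans ?_
    rw [hQ, ← hNdef]
    set Q := (53 * N / ε)⁻¹ with hQdef
    have hQ0 : 0 < Q := inv_pos.2 hpos
    have hQ1 : Q ≤ 1 := by
      rw [hQdef]
      refine inv_le_one_of_one_le₀ ?_
      rw [le_div_iff₀ hε]
      linarith
    have hε' : ε = 53 * N * Q := by
      rw [hQdef]
      field_simp
    have hNQ : 0 ≤ N * Q := by positivity
    -- The truncation error is `E = (52/9) √N Q`. As `Q ≤ 1`, the coefficient of `N Q` is at most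
    -- `104/9 + (52/9)² < 45`, which `53` covers.
    calc 8 / 9 * Real.sqrt N * (6.5 * Q) * (2 * Real.sqrt N + 8 / 9 * Real.sqrt N * (6.5 * Q))
        = Real.sqrt N ^ 2 * Q * (104 / 9 + (52 / 9) ^ 2 * Q) := by ring
      _ ≤ N * Q * 53 := by
          rw [hSsq]
          exact mul_le_mul_of_nonneg_left (by linarith) hNQ
      _ = ε := by rw [hε']; ring

lemma maxDiagonal_le_of_isSolution {Γ : Finset Plane} {S : Set (Matrix Γ Γ ℂ)} {A₀ : Matrix Γ Γ ℂ}
    (hA₀ : A₀ ∈ S) {C : ℝ} (hC : 0 ≤ C) (hdiag : ∀ l, (A₀ l l).re ≤ C) {A : Matrix Γ Γ ℂ}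
    (hA : IsSolution S A) : maxDiagonal A ≤ C :=
  -- Nonnegativity of `C` covers the case of empty `Γ`, where the supremum is `0`.
  (hA.2 hA₀).trans (Real.iSup_le hdiag hC)

lemma conj_mul_self_eq_norm_sq (w : ℂ) : (starRingEnd ℂ) w * w = ((‖w‖ ^ 2 : ℝ) : ℂ) := by
  rw [Complex.conj_mul', Complex.ofReal_pow]

/-- The Frobenius pairing conjugates `W_p`, so the conjugate of `c` must come first here; the ansatz
kernel is not conjugated and requires the opposite order. -/
lemma frobeniusInner_vecMulVec {Γ : Finset Plane} (c : Γ → ℂ) (p : Plane) :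
    frobeniusInner (Matrix.vecMulVec (star c) c) (evalMatrix Γ p) =
      ((‖∑ l, c l * evalVector Γ p l‖ ^ 2 : ℝ) : ℂ) := by
  rw [← conj_mul_self_eq_norm_sq, map_sum, Finset.sum_mul_sum, frobeniusInner]
  refine Finset.sum_congr rfl fun l _ => Finset.sum_congr rfl fun m _ => ?_
  simp only [Matrix.vecMulVec_apply, Pi.star_apply, evalMatrix, Matrix.of_apply, map_mul,
    Complex.conj_conj, RCLike.star_def]
  ring

lemma ansatzFunction_vecMulVec {Γ : Finset Plane} (c : Γ → ℂ) (p : Plane) :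
    ansatzFunction (Matrix.vecMulVec c (star c)) (fun i => (p i : ℂ)) =
      ((‖∑ l, c l * evalVector Γ p l‖ ^ 2 : ℝ) : ℂ) := by
  rw [← conj_mul_self_eq_norm_sq, mul_comm, map_sum, Finset.sum_mul_sum, ansatzFunction]
  refine Finset.sum_congr rfl fun l _ => Finset.sum_congr rfl fun m _ => ?_
  simp only [Matrix.vecMulVec_apply, Pi.star_apply, ansatzKernel_ofReal, evalVector, map_mul,
    RCLike.star_def]
  ring

end GaborPhase

theorem mainTheorem7 (f : ℝ → ℂ) (hf : MeasureTheory.MemLp f 2 MeasureTheory.volume)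
    (ε s : ℝ) (hε0 : 0 < ε) (hε1 : ε < 1) (hs : 0 < s)
    (Ω : Set GaborPhase.Plane) (hΩ : Ω ⊆ GaborPhase.squareLattice s)
    (Γ : Finset GaborPhase.Plane)
    (hΓ : (Γ : Set GaborPhase.Plane) ⊆ GaborPhase.squareLattice (1 / Real.sqrt 2))
    (hdist : ENNReal.ofReal
        (Real.sqrt (2 / Real.pi * Real.log (53 * GaborPhase.spectrogramSup f / ε))
          + 1 / (2 * Real.sqrt 2))
      ≤ GaborPhase.setDist Ω
          (GaborPhase.squareLattice (1 / Real.sqrt 2) \ (Γ : Set GaborPhase.Plane))) :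
    ((GaborPhase.admissibleSet ε f Γ Ω).Nonempty ∧
      ∀ A : Matrix Γ Γ ℂ, GaborPhase.IsSolution (GaborPhase.admissibleSet ε f Γ Ω) A →
        GaborPhase.maxDiagonal A ≤ 1.6 * GaborPhase.spectrogramSup f) ∧
    ((GaborPhase.ansatzAdmissibleSet ε f Γ Ω).Nonempty ∧
      ∀ A : Matrix Γ Γ ℂ, GaborPhase.IsSolution (GaborPhase.ansatzAdmissibleSet ε f Γ Ω) A →
        GaborPhase.maxDiagonal A ≤ 1.6 * GaborPhase.spectrogramSup f) := by

  obtain ⟨c, hc, hcε⟩ := GaborPhase.exists_admissible_vector hf hε0 Ω Γ hΓ hdist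
  have hC : 0 ≤ 1.6 * GaborPhase.spectrogramSup f :=
    mul_nonneg (by norm_num) (GaborPhase.spectrogramSup_nonneg f)
  have h1 : Matrix.vecMulVec (star c) c ∈ GaborPhase.admissibleSet ε f Γ Ω := by
    refine ⟨Matrix.posSemidef_vecMulVec_star_self c, fun p hp => ?_⟩
    rw [GaborPhase.frobeniusInner_vecMulVec, ← Complex.ofReal_sub, Complex.norm_real]
    exact hcε p hp
  have h2 : Matrix.vecMulVec c (star c) ∈ GaborPhase.ansatzAdmissibleSet ε f Γ Ω := by
    refine ⟨Matrix.posSemidef_vecMulVec_self_star c, fun p hp => ?_⟩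
    rw [GaborPhase.ansatzFunction_vecMulVec, ← Complex.ofReal_sub, Complex.norm_real]
    exact hcε p hp
  refine ⟨⟨⟨_, h1⟩, fun A hA => GaborPhase.maxDiagonal_le_of_isSolution h1 hC (fun l => ?_) hA⟩,
    ⟨_, h2⟩, fun A hA => GaborPhase.maxDiagonal_le_of_isSolution h2 hC (fun l => ?_) hA⟩
  · rw [Matrix.vecMulVec_apply, Pi.star_apply, RCLike.star_def,
      GaborPhase.conj_mul_self_eq_norm_sq, Complex.ofReal_re]
    exact hc l
  · rw [Matrix.vecMulVec_apply, Pi.star_apply, RCLike.star_def, mul_comm,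
      GaborPhase.conj_mul_self_eq_norm_sq, Complex.ofReal_re]
    exact hc l
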